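/- **Setting.** Let $R=K[x_1,\dots,x_r]$ be a polynomial ring over a field and let $g_1,\dots,g_m\in R$ be non-zero. Let $e_1,\dots,e_m$ be the standard basis of $R^m$ and put $\bar u=\sum_i u_ig_i$ for $u\in R^m$; $u$ is a *syzygy* if $\bar u=0$. Fix term orders $\le$ on $R$ and on $R^m$ with $a\le b\iff ae_i\le be_i$ for all monomials $a,b$ and all $i$. Let $\mathrm{hd}(f)$ be the lead term of $f\in R$ and let the *signature* $s(u)$ be the largest term of $u\in R^m$. Comparisons of signatures (equality, $\le$, divisibility) are up to non-zero scalars. An *extended basis* $G_n$ is a family $g_1,\dots,g_n$ ($n\ge m$) of non-zero elements of the ideal $\langle g_1,\dots,g_m\rangle$ together with elements $\alpha_1,\dots,\alpha_n\in R^m$ such that $\bar\alpha_i=g_i$ for all $i$, and $\alpha_i=e_i$ for $i\le m$. Relative to $G_n$, let $a$ be a monomial (scalar coefficients allowed). If $\mathrm{hd}(\overline{a\alpha_i})$ is a term of $\bar u$, then $u\mapsto u-a\alpha_i$ is a *reduction step* if $s(a\alpha_i)\le s(u)$ and a *regular* one if $s(a\alpha_i)<s(u)$; in a sequence of reduction steps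 starting at $u$, the bound is the signature of the starting element $u$. A *result of regular reducing* $u$ is an element reached from $u$ by regular steps and admitting no further regular step. A non-syzygy $u$ is *regular* (*singular*) *top reducible* if $\mathrm{hd}(\overline{a\alpha_i})=\mathrm{hd}(\bar u)$ for some $a,i$ with $s(a\alpha_i)<s(u)$ (with $s(a\alpha_i)=s(u)$). $G_n$ is a *signature Gröbner basis* if from every $u\in R^m$ reduction steps lead to a syzygy. It is *minimal* if no non-empty set of the elements with index $>m$ can be left out so that a signature Gröbner basis remains. The *S-pair* of $\alpha,\beta$ is $\frac{\mathrm{hd}(\bar\beta)}{d}\alpha-\frac{\mathrm{hd}(\bar\alpha)}{d}\beta$ with $d=\gcd(\mathrm{hd}(\bar\alpha),\mathrm{hd}(\bar\beta))$, and their *Koszul syzygy* is $\bar\beta\alpha-\bar\alpha\beta$. Only *regular* ones are considered, i.e. those whose two summands have different signatures. **Algorithm SB** (with elimination criteria). Start with the basis $e_1,\dots,e_m$, with the set $S$ of all S-pairs of $e_i,e_j$ ($i<j$), and with no known syzygy signatures. While $S\ne\emptyset$, remove from $S$ an S-pair $p$ of minimal signature $T$. Eliminate $p$ without reducing it if at least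 one of the following holds: * (signature criterion) a known syzygy signature divides $T$; * (duplicate signature) an S-pair of signature $T$ has already been reduced; * (Koszul criterion) $T$ is the signature of a Koszul syzygy among the current basis elements; * (relatively prime criterion) $T$ is the signature of an S-pair in $S$ (including $p$) whose two lead terms are relatively prime; * (singular criterion) among the monomial multiples $a\alpha_i$ of basis elements with $s(a\alpha_i)=T$, one with minimal lead term $\mathrm{hd}(\overline{a\alpha_i})$ is not regular top reducible. When $p$ is eliminated by the Koszul or the relatively prime criterion, $T$ is recorded as a known syzygy signature. If no criterion applies, *reduce* $p$: let $p'$ be a result of regular reducing $p$ by the current basis. If $p'$ is a syzygy, record $T$ as a known syzygy signature. Otherwise, if $p'$ is not singular top reducible, add $p'$ to the basis and the S-pairs between $p'$ and all earlier basis elements to $S$. Choices (of $p$ among the S-pairs of minimal signature, of the reducers, and of the criterion when several apply) are arbitrary. **Theorem.** Let $G_n$ be a minimal signature Gröbner basis extending $g_1,\dots,g_m$. Let $H\subseteq R^m$ be the initial submodule of the module of syzygies of $g_1,\dots,g_m$, and let $N$ be the set of monic minimal generators of $H$ that are not the signature of any Koszul syzygy among the elements of $G_n$. Then SB never gets stuck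 and always terminates, $N$ is finite, and the signatures of $\alpha_{m+1},\dots,\alpha_n$ and the elements of $N$ are pairwise distinct. In every complete run, SB reduces exactly one S-pair in the signature of each $\alpha_i$ with $m<i\le n$, exactly one S-pair in each signature $L\in N$, and no other S-pairs. In particular it reduces exactly $(n-m)+|N|$ S-pairs. -/

import Mathlib

open MvPolynomial

noncomputable section

namespace SigBasis

/-- The monic terms `x^exp · e_idx` of the free module `R^m`, `R = K[σ]`. -/
@[ext]
structure ModTerm (σ : Type*) (m : ℕ) where
  idx : Fin m
  exp : σ →₀ ℕ

/-- The product of the monomial `x^c` and a module term. -/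
def ModTerm.shift {σ : Type*} {m : ℕ} (c : σ →₀ ℕ) (t : ModTerm σ m) : ModTerm σ m :=
  ⟨t.idx, c + t.exp⟩

/-- Divisibility of module terms. -/
def ModTerm.Divides {σ : Type*} {m : ℕ} (s t : ModTerm σ m) : Prop :=
  ∃ c : σ →₀ ℕ, t = s.shift c

/-- The given linear order on the monic terms of `R^m` is a term order, related to the term order
`ord` on `R` by `a ≤ b ↔ a e_i ≤ b e_i`. -/
structure IsModTermOrder {σ : Type*} {m : ℕ} (ord : MonomialOrder σ)
    [LinearOrder (ModTerm σ m)] : Prop where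
  shift_le_shift : ∀ (c : σ →₀ ℕ) (s t : ModTerm σ m), s ≤ t → s.shift c ≤ t.shift c
  compatible : ∀ (i : Fin m) (a b : σ →₀ ℕ),
    ord.toSyn a ≤ ord.toSyn b ↔ (⟨i, a⟩ : ModTerm σ m) ≤ ⟨i, b⟩

/-- The free module `R^m` over `R = K[σ]`. -/
abbrev ModVec (σ K : Type*) [CommSemiring K] (m : ℕ) : Type _ := Fin m → MvPolynomial σ K

section Basic

variable {σ K : Type*} [Field K] {m : ℕ}

/-- A monic module term as an element of `R^m`. -/
def ModTerm.toVec (K : Type*) [Field K] (t : ModTerm σ m) : ModVec σ K m :=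
  Pi.single t.idx (monomial t.exp 1)

/-- The standard basis vector `e_i` of `R^m`. -/
def unit (σ K : Type*) [Field K] {m : ℕ} (i : Fin m) : ModVec σ K m := Pi.single i 1

/-- The homomorphism `u ↦ ∑ u_i g_i` from `R^m` to `R`. -/
def proj (g : Fin m → MvPolynomial σ K) (u : ModVec σ K m) : MvPolynomial σ K :=
  ∑ i, u i * g i

/-- The signature of `u ∈ R^m` up to a nonzero scalar: the largest monic term occurring in `u`;
it is `⊥` for `u = 0`. Term orders do not see scalars, so comparing these values with `<`, `≤`, `=`
is comparing signatures by `<`, `≤` and by equality up to a nonzero scalar. -/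
def sig [LinearOrder (ModTerm σ m)] (u : ModVec σ K m) : WithBot (ModTerm σ m) :=
  Finset.univ.sup fun i => (u i).support.sup fun a => ((⟨i, a⟩ : ModTerm σ m) : WithBot (ModTerm σ m))

end Basic

/-! A basis extending `g_1, …, g_m` is given by the set `B ⊆ R^m` of the representations
`φ(e_1), …, φ(e_n)` of its elements in terms of `g_1, …, g_m`, where `φ(e_i) = e_i` for `i ≤ m`.
The polynomial, the signature and all reductions of `u ∈ R^n` are determined by `φ(u) ∈ R^m`,
and `φ` is onto, so everything is phrased for elements of `R^m`. -/

section Reduction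

variable {σ K : Type*} [Field K] {m : ℕ}

/-- The multiples of the elements of `B` by (not necessarily monic) monomials. -/
def multiples (B : Set (ModVec σ K m)) : Set (ModVec σ K m) :=
  {r | ∃ β ∈ B, ∃ (a : σ →₀ ℕ) (c : K), c ≠ 0 ∧ r = monomial a c • β}

/-- The lead term of the polynomial of `r` is a term of the polynomial of `u`. -/
def CancelsTerm (ord : MonomialOrder σ) (g : Fin m → MvPolynomial σ K) (r u : ModVec σ K m) :
    Prop :=
  proj g r ≠ 0 ∧
    (proj g u).coeff (ord.degree (proj g r)) = ord.leadingCoeff (proj g r)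

/-- The lead term of the polynomial of `r` is the lead term of the polynomial of `u`. -/
def CancelsLead (ord : MonomialOrder σ) (g : Fin m → MvPolynomial σ K) (r u : ModVec σ K m) :
    Prop :=
  proj g r ≠ 0 ∧ proj g u ≠ 0 ∧ ord.leadingTerm (proj g r) = ord.leadingTerm (proj g u)

variable [LinearOrder (ModTerm σ m)]

/-- One reduction step by `B` that uses no reducer of signature above `T`. -/
def SStep (ord : MonomialOrder σ) (g : Fin m → MvPolynomial σ K) (B : Set (ModVec σ K m))
    (T : WithBot (ModTerm σ m)) (u v : ModVec σ K m) : Prop :=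
  ∃ r ∈ multiples B, CancelsTerm ord g r u ∧ sig r ≤ T ∧ v = u - r

/-- `u` S-reduces to zero: reduction steps that do not increase the signature lead from `u`
to a syzygy. -/
def SReducesToZero (ord : MonomialOrder σ) (g : Fin m → MvPolynomial σ K)
    (B : Set (ModVec σ K m)) (u : ModVec σ K m) : Prop :=
  ∃ r, Relation.ReflTransGen (SStep ord g B (sig u)) u r ∧ proj g r = 0

/-- One regular reduction step by `B`. -/
def RegStep (ord : MonomialOrder σ) (g : Fin m → MvPolynomial σ K) (B : Set (ModVec σ K m))
    (u v : ModVec σ K m) : Prop :=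
  ∃ r ∈ multiples B, CancelsTerm ord g r u ∧ sig r < sig u ∧ v = u - r

/-- `v` is a result of regular reducing `u` by `B`. -/
def RegReducesTo (ord : MonomialOrder σ) (g : Fin m → MvPolynomial σ K) (B : Set (ModVec σ K m))
    (u v : ModVec σ K m) : Prop :=
  Relation.ReflTransGen (RegStep ord g B) u v ∧ ¬ ∃ z, RegStep ord g B v z

/-- `u` is regular top reducible by `B`. -/
def RegTopReducible (ord : MonomialOrder σ) (g : Fin m → MvPolynomial σ K)
    (B : Set (ModVec σ K m)) (u : ModVec σ K m) : Prop :=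
  ∃ r ∈ multiples B, CancelsLead ord g r u ∧ sig r < sig u

/-- `u` is singular top reducible by `B`. -/
def SingTopReducible (ord : MonomialOrder σ) (g : Fin m → MvPolynomial σ K)
    (B : Set (ModVec σ K m)) (u : ModVec σ K m) : Prop :=
  ∃ r ∈ multiples B, CancelsLead ord g r u ∧ sig r = sig u

/-- `B` is a signature Gröbner basis: every element S-reduces to zero. -/
def IsSigGB (ord : MonomialOrder σ) (g : Fin m → MvPolynomial σ K) (B : Set (ModVec σ K m)) :
    Prop :=
  ∀ u, SReducesToZero ord g B u

/-- The basis consisting of the original generators `e_1, …, e_m` and of the elements `w j`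
for `j ∈ J`. -/
def extension {k : ℕ} (w : Fin k → ModVec σ K m) (J : Set (Fin k)) : Set (ModVec σ K m) :=
  Set.range (unit σ K) ∪ w '' J

/-- The original generators together with `w_1, …, w_k` (whose polynomials are nonzero) form
a minimal signature Gröbner basis: no `w j` can be left out. -/
structure IsMinimalSigGB (ord : MonomialOrder σ) (g : Fin m → MvPolynomial σ K) {k : ℕ}
    (w : Fin k → ModVec σ K m) : Prop where
  proj_ne_zero : ∀ j, proj g (w j) ≠ 0
  isSigGB : IsSigGB ord g (extension w Set.univ)
  minimal : ∀ J : Set (Fin k), IsSigGB ord g (extension w J) → J = Set.univ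

end Reduction

section Pairs

variable {σ K : Type*} [Field K] {m : ℕ}

/-- The monomial `hd(β̄) / gcd(hd(ᾱ), hd(β̄))`, the multiplier of `α` in the S-pair of `α`, `β`. -/
def cofactor (ord : MonomialOrder σ) (g : Fin m → MvPolynomial σ K) (α β : ModVec σ K m) :
    MvPolynomial σ K :=
  monomial (ord.degree (proj g β) - ord.degree (proj g α) ⊓ ord.degree (proj g β))
    (ord.leadingCoeff (proj g β))

/-- The S-pair of `α` and `β`. -/
def spair (ord : MonomialOrder σ) (g : Fin m → MvPolynomial σ K) (α β : ModVec σ K m) :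
    ModVec σ K m :=
  cofactor ord g α β • α - cofactor ord g β α • β

/-- The Koszul syzygy of `α` and `β`. -/
def koszul (g : Fin m → MvPolynomial σ K) (α β : ModVec σ K m) : ModVec σ K m :=
  proj g β • α - proj g α • β

/-- The lead terms of the polynomials of `α` and `β` are relatively prime. -/
def RelPrime (ord : MonomialOrder σ) (g : Fin m → MvPolynomial σ K) (α β : ModVec σ K m) : Prop :=
  ord.degree (proj g α) ⊓ ord.degree (proj g β) = 0

variable [LinearOrder (ModTerm σ m)]

/-- The S-pair of `α` and `β` is regular. -/
def RegularSPair (ord : MonomialOrder σ) (g : Fin m → MvPolynomial σ K) (α β : ModVec σ K m) :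
    Prop :=
  sig (cofactor ord g α β • α) ≠ sig (cofactor ord g β α • β)

/-- `T` is (up to a scalar) the signature of a regular Koszul syzygy among the elements of `B`. -/
def IsKoszulSig (g : Fin m → MvPolynomial σ K) (B : Set (ModVec σ K m)) (T : ModTerm σ m) : Prop :=
  ∃ α ∈ B, ∃ β ∈ B, sig (proj g β • α) ≠ sig (proj g α • β) ∧ sig (koszul g α β) = T

/-- The initial submodule of the syzygy module of `g_1, …, g_m`. -/
def initialSyz (g : Fin m → MvPolynomial σ K) : Submodule (MvPolynomial σ K) (ModVec σ K m) :=
  Submodule.span _ {v | ∃ (u : ModVec σ K m) (T : ModTerm σ m),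
    proj g u = 0 ∧ sig u = T ∧ v = T.toVec K}

/-- The (monic) minimal generators of a submodule of `R^m` generated by terms. -/
def minGens (H : Submodule (MvPolynomial σ K) (ModVec σ K m)) : Set (ModTerm σ m) :=
  {T | T.toVec K ∈ H ∧ ∀ L : ModTerm σ m, L.toVec K ∈ H → L.Divides T → L = T}

end Pairs

section Algorithm

/-- A state of the algorithm. -/
structure SBState (σ K : Type*) [Field K] (m : ℕ) where
  /-- the current basis -/
  basis : Set (ModVec σ K m)
  /-- the S-pairs that are waiting to be processed -/
  pairs : Set (ModVec σ K m × ModVec σ K m)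
  /-- the known syzygy signatures, which generate the current approximation of `H` -/
  known : Set (ModTerm σ m)
  /-- the S-pairs that have been regular reduced so far -/
  reduced : List (ModVec σ K m × ModVec σ K m)

variable {σ K : Type*} [Field K] {m : ℕ} [LinearOrder (ModTerm σ m)]

/-- Signature of the S-pair `p`. -/
def pairSig (ord : MonomialOrder σ) (g : Fin m → MvPolynomial σ K)
    (p : ModVec σ K m × ModVec σ K m) : WithBot (ModTerm σ m) :=
  sig (spair ord g p.1 p.2)

/-- The initial state. -/
def sbInit (ord : MonomialOrder σ) (g : Fin m → MvPolynomial σ K) : SBState σ K m where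
  basis := Set.range (unit σ K)
  pairs := {p | ∃ i j : Fin m, i < j ∧ p = (unit σ K i, unit σ K j) ∧ RegularSPair ord g p.1 p.2}
  known := ∅
  reduced := []

/-- Signature criterion: a known syzygy signature divides `T`. -/
def SignatureCriterion (st : SBState σ K m) (T : ModTerm σ m) : Prop :=
  ∃ L ∈ st.known, L.Divides T

/-- Duplicate-signature criterion: an S-pair in signature `T` has already been reduced. -/
def DuplicateCriterion (ord : MonomialOrder σ) (g : Fin m → MvPolynomial σ K)
    (st : SBState σ K m) (T : ModTerm σ m) : Prop :=
  ∃ q ∈ st.reduced, pairSig ord g q = T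

/-- Singular criterion: among the monomial multiples of basis elements with signature `T`, one with
minimal lead term is not regular top reducible. -/
def SingularCriterion (ord : MonomialOrder σ) (g : Fin m → MvPolynomial σ K)
    (st : SBState σ K m) (T : ModTerm σ m) : Prop :=
  ∃ u ∈ multiples st.basis, sig u = T ∧
    (∀ v ∈ multiples st.basis, sig v = T →
      ord.toSyn (ord.degree (proj g u)) ≤ ord.toSyn (ord.degree (proj g v))) ∧
    ¬ RegTopReducible ord g st.basis u

/-- Koszul criterion: `T` is the signature of a Koszul syzygy among the current basis elements. -/
def KoszulCriterion (g : Fin m → MvPolynomial σ K) (st : SBState σ K m) (T : ModTerm σ m) : Prop :=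
  IsKoszulSig g st.basis T

/-- Relatively prime criterion: some waiting S-pair in signature `T` has relatively prime
lead terms. -/
def RelPrimeCriterion (ord : MonomialOrder σ) (g : Fin m → MvPolynomial σ K)
    (st : SBState σ K m) (T : ModTerm σ m) : Prop :=
  ∃ q ∈ st.pairs, pairSig ord g q = T ∧ RelPrime ord g q.1 q.2

/-- `p` is a waiting S-pair with minimal signature, and its signature is `T`. -/
def IsNext (ord : MonomialOrder σ) (g : Fin m → MvPolynomial σ K) (st : SBState σ K m)
    (p : ModVec σ K m × ModVec σ K m) (T : ModTerm σ m) : Prop :=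
  p ∈ st.pairs ∧ (∀ q ∈ st.pairs, pairSig ord g p ≤ pairSig ord g q) ∧ pairSig ord g p = T

/-- None of the elimination criteria applies in signature `T`. -/
def NotEliminated (ord : MonomialOrder σ) (g : Fin m → MvPolynomial σ K)
    (st : SBState σ K m) (T : ModTerm σ m) : Prop :=
  ¬ SignatureCriterion st T ∧ ¬ DuplicateCriterion ord g st T ∧ ¬ KoszulCriterion g st T ∧
    ¬ RelPrimeCriterion ord g st T ∧ ¬ SingularCriterion ord g st T

/-- One pass through the main loop of the algorithm: take a waiting S-pair of minimal signature;
eliminate it if a criterion applies, otherwise regular reduce it. The choice of the S-pair among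
those of minimal signature and the choice of the reducers are left open. -/
inductive SBStep (ord : MonomialOrder σ) (g : Fin m → MvPolynomial σ K) :
    SBState σ K m → SBState σ K m → Prop
  /-- elimination by the signature, the duplicate-signature or the singular criterion -/
  | eliminate (st : SBState σ K m) (p : ModVec σ K m × ModVec σ K m) (T : ModTerm σ m) :
      IsNext ord g st p T →
      SignatureCriterion st T ∨ DuplicateCriterion ord g st T ∨ SingularCriterion ord g st T →
      SBStep ord g st ⟨st.basis, st.pairs \ {p}, st.known, st.reduced⟩
  /-- elimination by the Koszul or the relatively prime criterion; this shows that `T` is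
  a syzygy signature -/
  | eliminateKoszul (st : SBState σ K m) (p : ModVec σ K m × ModVec σ K m) (T : ModTerm σ m) :
      IsNext ord g st p T →
      KoszulCriterion g st T ∨ RelPrimeCriterion ord g st T →
      SBStep ord g st ⟨st.basis, st.pairs \ {p}, insert T st.known, st.reduced⟩
  /-- the S-pair regular reduces to a syzygy -/
  | reduceToSyzygy (st : SBState σ K m) (p : ModVec σ K m × ModVec σ K m) (T : ModTerm σ m)
      (v : ModVec σ K m) :
      IsNext ord g st p T → NotEliminated ord g st T →
      RegReducesTo ord g st.basis (spair ord g p.1 p.2) v →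
      proj g v = 0 →
      SBStep ord g st ⟨st.basis, st.pairs \ {p}, insert T st.known, p :: st.reduced⟩
  /-- the S-pair regular reduces to a singular top reducible element, which is thrown away -/
  | reduceToSingular (st : SBState σ K m) (p : ModVec σ K m × ModVec σ K m) (T : ModTerm σ m)
      (v : ModVec σ K m) :
      IsNext ord g st p T → NotEliminated ord g st T →
      RegReducesTo ord g st.basis (spair ord g p.1 p.2) v →
      proj g v ≠ 0 → SingTopReducible ord g st.basis v →
      SBStep ord g st ⟨st.basis, st.pairs \ {p}, st.known, p :: st.reduced⟩
  /-- the S-pair regular reduces to a new basis element -/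
  | reduceToBasis (st : SBState σ K m) (p : ModVec σ K m × ModVec σ K m) (T : ModTerm σ m)
      (v : ModVec σ K m) :
      IsNext ord g st p T → NotEliminated ord g st T →
      RegReducesTo ord g st.basis (spair ord g p.1 p.2) v →
      proj g v ≠ 0 → ¬ SingTopReducible ord g st.basis v →
      SBStep ord g st ⟨insert v st.basis,
        (st.pairs \ {p}) ∪ {q | q.1 ∈ st.basis ∧ q.2 = v ∧ RegularSPair ord g q.1 q.2},
        st.known, p :: st.reduced⟩

/-- The states that a run of the algorithm on `g_1, …, g_m` can reach. -/
def SBReachable (ord : MonomialOrder σ) (g : Fin m → MvPolynomial σ K) (st : SBState σ K m) :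
    Prop :=
  Relation.ReflTransGen (SBStep ord g) (sbInit ord g) st

/-- The minimal generators of the initial syzygy module of `g_1, …, g_m` that are not the signature
of any Koszul syzygy among the elements of `B`. -/
def nonKoszulGens (g : Fin m → MvPolynomial σ K) (B : Set (ModVec σ K m)) : Set (ModTerm σ m) :=
  {T | T ∈ minGens (initialSyz g) ∧ ¬ IsKoszulSig g B T}

end Algorithm

end SigBasis

end

/-! Everything is read off from optimal elements: for a signature `T`, those elements of signature
`T` whose polynomial has the smallest possible lead monomial (`IsMin`). This notion does not depend
on a basis. A basis covers `T` if some monomial multiple of one of its elements is optimal in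
signature `T` and is not a syzygy.

A non-optimal element shares its lead monomial with an element of smaller signature, so induction on
the signature finds reducers. Hence a basis is a signature Gröbner basis iff it covers every
signature that is not a syzygy signature (`isSigGB_iff`). Divisors of optimal elements are optimal,
so it suffices to cover the signatures whose optimal elements are not proper multiples. Those not
already served by some `e_i` are the new signatures (`IsNewSig`), and a minimal signature Gröbner
basis has exactly one additional element in each of them (`sig_of_isMinimalSigGB`).

For the algorithm, call a signature settled if a known syzygy signature divides it or the basis
covers it. A Buchberger criterion by signature (`settled_of_spairs`) says that `T` is settled once
all regular S-pairs of signature at most `T` are. So when an S-pair of minimal signature `T` is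
taken, everything below `T` is settled. Then non-syzygies in signature `T` that are not regular top
reducible are optimal, and the singular criterion tests exactly whether `T` is covered. If no
criterion applies and the result is not a syzygy, `T` is therefore a new signature. If the result is
a syzygy, `T` is a minimal generator of the initial syzygy module, and it is no Koszul signature for
the final basis either, because below `T` the current basis matches the final one in signatures and
lead monomials.

Thus reductions occur only in the claimed signatures, at most once in each by the duplicate
criterion, which bounds their number and gives termination. Conversely, at the end every signature
is settled. A new signature then has a basis element, which came from a reduction. A minimal
generator that is not a Koszul signature is itself a known signature, and it can only have become
known through a reduction. -/

noncomputable section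

namespace SigBasis

/-! ### Terms and signatures in the free module -/

section SigBasics

variable {σ K : Type*} [Field K] {m : ℕ}

/-- The coefficient of a module term in an element of `R^m`. -/
def mcoeff (u : ModVec σ K m) (T : ModTerm σ m) : K := (u T.idx).coeff T.exp

lemma mcoeff_sub (u v : ModVec σ K m) (T : ModTerm σ m) :
    mcoeff (u - v) T = mcoeff u T - mcoeff v T := by
  simp [mcoeff]

lemma mcoeff_add (u v : ModVec σ K m) (T : ModTerm σ m) :
    mcoeff (u + v) T = mcoeff u T + mcoeff v T := by
  simp [mcoeff]

lemma exists_shift_of_mcoeff_smul_ne_zero {p : MvPolynomial σ K} {u : ModVec σ K m}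
    {T : ModTerm σ m} (h : mcoeff (p • u) T ≠ 0) :
    ∃ a ∈ p.support, ∃ S, mcoeff u S ≠ 0 ∧ T = S.shift a := by
  classical
  simp only [mcoeff, Pi.smul_apply, smul_eq_mul, coeff_mul] at h
  obtain ⟨⟨a, b⟩, hab, hne⟩ := Finset.exists_ne_zero_of_sum_ne_zero h
  refine ⟨a, mem_support_iff.2 (left_ne_zero_of_mul hne), ⟨T.idx, b⟩, right_ne_zero_of_mul hne, ?_⟩
  rw [Finset.HasAntidiagonal.mem_antidiagonal] at hab
  ext1
  · rfl
  · exact hab.symm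

lemma mcoeff_toVec (T S : ModTerm σ m) : mcoeff (T.toVec K) S ≠ 0 ↔ S = T := by
  classical
  obtain ⟨i, a⟩ := T
  obtain ⟨j, b⟩ := S
  by_cases h : j = i
  · subst h
    simp [mcoeff, ModTerm.toVec, coeff_monomial, eq_comm]
  · simp [mcoeff, ModTerm.toVec, h]

lemma ModTerm.shift_shift (a b : σ →₀ ℕ) (T : ModTerm σ m) :
    (T.shift a).shift b = T.shift (b + a) := by
  simp [ModTerm.shift, add_assoc]

lemma ModTerm.shift_zero (T : ModTerm σ m) : T.shift 0 = T := by
  simp [ModTerm.shift]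

lemma ModTerm.shift_injective (a : σ →₀ ℕ) :
    Function.Injective (ModTerm.shift a : ModTerm σ m → ModTerm σ m) := by
  intro S T h
  simp only [ModTerm.shift, ModTerm.mk.injEq, add_right_inj] at h
  exact ModTerm.ext h.1 h.2

lemma ModTerm.Divides.trans {A B C : ModTerm σ m} (h : A.Divides B) (h' : B.Divides C) :
    A.Divides C := by
  obtain ⟨a, rfl⟩ := h
  obtain ⟨b, rfl⟩ := h'
  exact ⟨b + a, ModTerm.shift_shift _ _ _⟩

lemma ModTerm.divides_refl (A : ModTerm σ m) : A.Divides A := ⟨0, A.shift_zero.symm⟩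

variable [LinearOrder (ModTerm σ m)]

lemma sig_le_iff {u : ModVec σ K m} {x : WithBot (ModTerm σ m)} :
    sig u ≤ x ↔ ∀ T : ModTerm σ m, mcoeff u T ≠ 0 → (T : WithBot (ModTerm σ m)) ≤ x := by
  simp only [sig, Finset.sup_le_iff, Finset.mem_univ, true_imp_iff, mem_support_iff]
  exact ⟨fun h T hT => h T.idx T.exp hT, fun h i a ha => h ⟨i, a⟩ ha⟩

lemma sig_lt_coe_iff {u : ModVec σ K m} {S : ModTerm σ m} :
    sig u < S ↔ ∀ T : ModTerm σ m, mcoeff u T ≠ 0 → T < S := by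
  simp only [sig, Finset.sup_lt_iff (WithBot.bot_lt_coe S), Finset.mem_univ, true_imp_iff,
    mem_support_iff, WithBot.coe_lt_coe]
  exact ⟨fun h T hT => h T.idx T.exp hT, fun h i a ha => h ⟨i, a⟩ ha⟩

lemma le_sig {u : ModVec σ K m} {T : ModTerm σ m} (h : mcoeff u T ≠ 0) :
    (T : WithBot (ModTerm σ m)) ≤ sig u :=
  sig_le_iff.1 le_rfl T h

lemma mcoeff_ne_zero_of_sig {u : ModVec σ K m} {T : ModTerm σ m} (h : sig u = T) :
    mcoeff u T ≠ 0 := by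
  intro h0
  refine absurd h (ne_of_lt (sig_lt_coe_iff.2 fun S hS => lt_of_le_of_ne ?_ ?_))
  · exact WithBot.coe_le_coe.1 (h ▸ le_sig hS)
  · rintro rfl
    exact hS h0

lemma sig_eq_coe_iff {u : ModVec σ K m} {T : ModTerm σ m} :
    sig u = T ↔ mcoeff u T ≠ 0 ∧ ∀ S, mcoeff u S ≠ 0 → S ≤ T :=
  ⟨fun h => ⟨mcoeff_ne_zero_of_sig h, fun _ hS => WithBot.coe_le_coe.1 (h ▸ le_sig hS)⟩,
    fun h => le_antisymm (sig_le_iff.2 fun S hS => WithBot.coe_le_coe.2 (h.2 S hS)) (le_sig h.1)⟩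

lemma sig_eq_bot_iff {u : ModVec σ K m} : sig u = ⊥ ↔ u = 0 := by
  constructor
  · intro h
    ext i a
    by_contra hne
    have := le_sig (u := u) (T := ⟨i, a⟩) (by simpa [mcoeff] using hne)
    rw [h] at this
    simp at this
  · rintro rfl
    simp [sig]

lemma sig_toVec (T : ModTerm σ m) : sig (T.toVec K) = T := by
  rw [sig_eq_coe_iff]
  exact ⟨(mcoeff_toVec T T).2 rfl, fun S hS => ((mcoeff_toVec T S).1 hS).le⟩

lemma sig_unit (i : Fin m) : sig (unit σ K i) = (⟨i, 0⟩ : ModTerm σ m) := by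
  rw [← sig_toVec (K := K)]
  rfl

lemma sig_sub_le (u v : ModVec σ K m) : sig (u - v) ≤ sig u ⊔ sig v := by
  refine sig_le_iff.2 fun T hT => ?_
  rw [mcoeff_sub] at hT
  by_cases h : mcoeff u T = 0
  · have : mcoeff v T ≠ 0 := by
      rintro h'
      simp [h, h'] at hT
    exact (le_sig this).trans le_sup_right
  · exact (le_sig h).trans le_sup_left

lemma sig_neg (v : ModVec σ K m) : sig (-v) = sig v := by simp [sig]

lemma sig_sub_of_lt {u v : ModVec σ K m} (h : sig v < sig u) : sig (u - v) = sig u := by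
  refine le_antisymm ((sig_sub_le u v).trans (by simp [h.le])) ?_
  have := sig_sub_le (u - v) (-v)
  rw [sub_neg_eq_add, sub_add_cancel, sig_neg] at this
  exact (le_sup_iff.1 this).resolve_right (not_le.2 h)

lemma sig_sub_comm (u v : ModVec σ K m) : sig (u - v) = sig (v - u) := by
  rw [← neg_sub, sig_neg]

lemma sig_sub_of_ne {u v : ModVec σ K m} (h : sig u ≠ sig v) : sig (u - v) = sig u ⊔ sig v := by
  rcases lt_or_gt_of_ne h with h | h
  · rw [sig_sub_comm, sig_sub_of_lt h, sup_eq_right.2 h.le]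
  · rw [sig_sub_of_lt h, sup_eq_left.2 h.le]

/-- Elements of the same signature can be combined to an element of smaller signature. -/
lemma exists_sig_sub_smul_lt {u v : ModVec σ K m} {T : ModTerm σ m} (hu : sig u = T)
    (hv : sig v = T) : ∃ c : K, c ≠ 0 ∧ sig (u - c • v) < T := by
  obtain ⟨hu0, hu1⟩ := sig_eq_coe_iff.1 hu
  obtain ⟨hv0, hv1⟩ := sig_eq_coe_iff.1 hv
  refine ⟨mcoeff u T / mcoeff v T, div_ne_zero hu0 hv0, sig_lt_coe_iff.2 fun S hS => ?_⟩
  have hsm : mcoeff ((mcoeff u T / mcoeff v T) • v) S = mcoeff u T / mcoeff v T * mcoeff v S := by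
    simp [mcoeff]
  rw [mcoeff_sub, hsm] at hS
  refine lt_of_le_of_ne ?_ ?_
  · by_cases h : mcoeff u S = 0
    · refine hv1 S fun h' => hS (by simp [h, h'])
    · exact hu1 S h
  · rintro rfl
    exact hS (by field_simp; simp)

end SigBasics

/-! ### Compatibility of signatures with multiplication -/

section Order

variable {σ K : Type*} [Field K] {m : ℕ} {ord : MonomialOrder σ} [LinearOrder (ModTerm σ m)]

namespace IsModTermOrder

variable (hord : IsModTermOrder (m := m) ord)
include hord

lemma strictMono_shift (a : σ →₀ ℕ) :
    StrictMono (ModTerm.shift a : ModTerm σ m → ModTerm σ m) :=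
  Monotone.strictMono_of_injective (fun s t h => hord.shift_le_shift a s t h)
    (ModTerm.shift_injective a)

lemma shift_le_shift_left {a b : σ →₀ ℕ} (h : ord.toSyn a ≤ ord.toSyn b) (T : ModTerm σ m) :
    T.shift a ≤ T.shift b := by
  refine (hord.compatible T.idx (a + T.exp) (b + T.exp)).1 ?_
  simpa using h

lemma shift_lt_shift_left {a b : σ →₀ ℕ} (h : ord.toSyn a < ord.toSyn b) (T : ModTerm σ m) :
    T.shift a < T.shift b := by
  refine lt_of_le_of_ne (hord.shift_le_shift_left h.le T) fun he => h.ne ?_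
  simp only [ModTerm.shift, ModTerm.mk.injEq, add_left_inj] at he
  rw [he.2]

lemma le_shift (a : σ →₀ ℕ) (T : ModTerm σ m) : T ≤ T.shift a := by
  have := hord.shift_le_shift_left (a := 0) (b := a) (by simp) T
  rwa [T.shift_zero] at this

lemma le_of_divides {S T : ModTerm σ m} (h : S.Divides T) : S ≤ T := by
  obtain ⟨a, rfl⟩ := h
  exact hord.le_shift a S

/-- Dickson's lemma: in any infinite sequence of terms an earlier one divides a later one, and a
divisor is never larger. -/
lemma wellFoundedLT [Finite σ] : WellFoundedLT (ModTerm σ m) := by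
  refine ⟨?_⟩
  rw [RelEmbedding.wellFounded_iff_isEmpty]
  refine ⟨fun f => ?_⟩
  have hw : WellQuasiOrdered (fun x y : Fin m × (σ →₀ ℕ) => x.1 = y.1 ∧ x.2 ≤ y.2) :=
    WellQuasiOrdered.prod (r := fun x y : Fin m => x = y) (s := fun x y : σ →₀ ℕ => x ≤ y)
      (Finite.wellQuasiOrdered _) wellQuasiOrdered_le
  obtain ⟨i, j, hij, h1, h2⟩ := hw fun n => ((f n).idx, (f n).exp)
  have hd : (f i).Divides (f j) :=
    ⟨(f j).exp - (f i).exp, ModTerm.ext h1.symm (tsub_add_cancel_of_le h2).symm⟩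
  exact absurd (hord.le_of_divides hd) (not_le.2 (f.map_rel_iff.2 hij))

/-- The signature of a product of a polynomial and an element of `R^m`. -/
lemma sig_smul {p : MvPolynomial σ K} (hp : p ≠ 0) (u : ModVec σ K m) :
    sig (p • u) = (sig u).map (ModTerm.shift (ord.degree p)) := by
  classical
  rcases hu : sig u with _ | T
  · rw [sig_eq_bot_iff.1 hu, smul_zero]
    exact sig_eq_bot_iff.2 rfl
  obtain ⟨h0, h1⟩ := sig_eq_coe_iff.1 (show sig u = (T : WithBot (ModTerm σ m)) from hu)
  change sig (p • u) = ((T.shift (ord.degree p) : ModTerm σ m) : WithBot (ModTerm σ m))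
  rw [sig_eq_coe_iff]
  constructor
  · change coeff (ord.degree p + T.exp) (p * u T.idx) ≠ 0
    -- No cancellation can occur here: in any other nonzero product both exponents are bounded by
    -- the maximal ones, and equal sums then force equality.
    rw [coeff_mul, Finset.sum_eq_single (ord.degree p, T.exp)]
    · exact mul_ne_zero (ord.leadingCoeff_ne_zero_iff.2 hp) h0
    · rintro ⟨a, b⟩ hab hne
      rw [Finset.HasAntidiagonal.mem_antidiagonal] at hab
      by_contra hmul
      have ha := ord.le_degree (mem_support_iff.2 (left_ne_zero_of_mul hmul))
      have hb := h1 ⟨T.idx, b⟩ (right_ne_zero_of_mul hmul)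
      have hb' := (hord.compatible T.idx b T.exp).2 hb
      have hs : ord.toSyn a + ord.toSyn b = ord.toSyn (ord.degree p) + ord.toSyn T.exp := by
        rw [← map_add, ← map_add]
        exact congrArg _ hab
      simp only at ha
      have h3 : ord.toSyn a = ord.toSyn (ord.degree p) := by
        refine le_antisymm ha (le_of_not_gt fun hlt => ?_)
        exact absurd hs (add_lt_add_of_lt_of_le hlt hb').ne
      have h4 : a = ord.degree p := ord.toSyn.injective h3
      subst h4
      exact hne (by rw [Prod.mk.injEq]; exact ⟨rfl, add_left_cancel hab⟩)
    · intro h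
      simp [Finset.HasAntidiagonal.mem_antidiagonal] at h
  · intro S hS
    obtain ⟨a, ha, S', hS', rfl⟩ := exists_shift_of_mcoeff_smul_ne_zero hS
    exact (hord.shift_le_shift a _ _ (h1 S' hS')).trans
      (hord.shift_le_shift_left (ord.le_degree ha) T)

lemma sig_monomial_smul (a : σ →₀ ℕ) {c : K} (hc : c ≠ 0) (u : ModVec σ K m) :
    sig (monomial a c • u) = (sig u).map (ModTerm.shift a) := by
  classical
  rw [hord.sig_smul (by simpa using hc) u, ord.degree_monomial, if_neg hc]

end IsModTermOrder

lemma sig_smul_scalar {c : K} (hc : c ≠ 0) (u : ModVec σ K m) : sig (c • u) = sig u := by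
  have : ∀ T, mcoeff (c • u) T = c * mcoeff u T := fun T => by simp [mcoeff]
  refine eq_of_forall_ge_iff fun x => ?_
  simp [sig_le_iff, this, hc]

end Order

/-! ### Lead monomials and optimal elements -/

section Lead

variable {σ K : Type*} [Field K] {m : ℕ}

lemma proj_sub (g : Fin m → MvPolynomial σ K) (u v : ModVec σ K m) :
    proj g (u - v) = proj g u - proj g v := by
  simp [proj, sub_mul]

lemma proj_smul (g : Fin m → MvPolynomial σ K) (p : MvPolynomial σ K) (u : ModVec σ K m) :
    proj g (p • u) = p * proj g u := by
  simp [proj, Finset.mul_sum, mul_assoc]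

lemma proj_smul_scalar (g : Fin m → MvPolynomial σ K) (c : K) (u : ModVec σ K m) :
    proj g (c • u) = C c * proj g u := by
  simp [proj, Finset.mul_sum, smul_eq_C_mul, mul_assoc]

lemma proj_unit (g : Fin m → MvPolynomial σ K) (i : Fin m) : proj g (unit σ K i) = g i := by
  classical
  simp [proj, unit, Pi.single_apply]

lemma smul_eq_monomial_smul (c : K) (u : ModVec σ K m) :
    c • u = (monomial 0 c : MvPolynomial σ K) • u := by
  funext i
  rw [monomial_zero']
  simp [smul_eq_C_mul]

lemma mem_multiples_self {B : Set (ModVec σ K m)} {β : ModVec σ K m} (h : β ∈ B) :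
    β ∈ multiples B :=
  ⟨β, h, 0, 1, one_ne_zero, by rw [← smul_eq_monomial_smul, one_smul]⟩

lemma monomial_smul_mem_multiples {B : Set (ModVec σ K m)} {r : ModVec σ K m}
    (h : r ∈ multiples B) (a : σ →₀ ℕ) {c : K} (hc : c ≠ 0) :
    (monomial a c : MvPolynomial σ K) • r ∈ multiples B := by
  obtain ⟨β, hβ, b, d, hd, rfl⟩ := h
  exact ⟨β, hβ, a + b, c * d, mul_ne_zero hc hd, by rw [smul_smul, monomial_mul]⟩

lemma smul_mem_multiples {B : Set (ModVec σ K m)} {r : ModVec σ K m}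
    (h : r ∈ multiples B) {c : K} (hc : c ≠ 0) : c • r ∈ multiples B := by
  rw [smul_eq_monomial_smul]
  exact monomial_smul_mem_multiples h 0 hc

lemma multiples_mono {B B' : Set (ModVec σ K m)} (h : B ⊆ B') : multiples B ⊆ multiples B' := by
  rintro r ⟨β, hβ, hr⟩
  exact ⟨β, h hβ, hr⟩

/-- The lead monomial of the polynomial of `u`; it is `⊥` for a syzygy. -/
def lead (ord : MonomialOrder σ) (g : Fin m → MvPolynomial σ K) (u : ModVec σ K m) :
    WithBot ord.syn :=
  ord.toWithBotSyn (ord.withBotDegree (proj g u))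

/-- Distinct minimal generators do not divide each other, so an infinite set of them would
contradict Dickson's lemma. -/
lemma finite_minGens [Finite σ] (H : Submodule (MvPolynomial σ K) (ModVec σ K m)) :
    (minGens H).Finite := by
  by_contra hinf
  let f := Set.Infinite.natEmbedding _ hinf
  have hw : WellQuasiOrdered (fun x y : Fin m × (σ →₀ ℕ) => x.1 = y.1 ∧ x.2 ≤ y.2) :=
    WellQuasiOrdered.prod (r := fun x y : Fin m => x = y) (s := fun x y : σ →₀ ℕ => x ≤ y)
      (Finite.wellQuasiOrdered _) wellQuasiOrdered_le
  obtain ⟨i, j, hij, h1, h2⟩ := hw fun n => ((f n).1.idx, (f n).1.exp)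
  have hd : (f i).1.Divides (f j).1 :=
    ⟨(f j).1.exp - (f i).1.exp, ModTerm.ext h1.symm (tsub_add_cancel_of_le h2).symm⟩
  exact hij.ne (f.injective (Subtype.ext ((f j).2.2 _ (f i).2.1 hd)))

variable {ord : MonomialOrder σ} {g : Fin m → MvPolynomial σ K}

lemma lead_eq_bot_iff {u : ModVec σ K m} : lead ord g u = ⊥ ↔ proj g u = 0 := by
  simp [lead]

lemma lead_eq_coe {u : ModVec σ K m} (h : proj g u ≠ 0) :
    lead ord g u = (ord.toSyn (ord.degree (proj g u)) : ord.syn) := by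
  rw [lead, (ord.withBotDegree_eq_coe_degree_iff _).2 h]
  rfl

lemma lead_eq_lead_iff {u v : ModVec σ K m} (hu : proj g u ≠ 0) (hv : proj g v ≠ 0) :
    lead ord g u = lead ord g v ↔ ord.degree (proj g u) = ord.degree (proj g v) := by
  rw [lead_eq_coe hu, lead_eq_coe hv, WithBot.coe_inj, ord.toSyn.injective.eq_iff]

lemma lead_le_lead_iff {u v : ModVec σ K m} (hu : proj g u ≠ 0) (hv : proj g v ≠ 0) :
    lead ord g u ≤ lead ord g v ↔
      ord.toSyn (ord.degree (proj g u)) ≤ ord.toSyn (ord.degree (proj g v)) := by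
  rw [lead_eq_coe hu, lead_eq_coe hv, WithBot.coe_le_coe]

lemma proj_ne_zero_of_lead_eq {u v : ModVec σ K m} (h : lead ord g u = lead ord g v)
    (hv : proj g v ≠ 0) : proj g u ≠ 0 := fun h0 =>
  hv (lead_eq_bot_iff.1 (h ▸ lead_eq_bot_iff.2 h0))

lemma lead_monomial_smul (a : σ →₀ ℕ) {c : K} (hc : c ≠ 0) (u : ModVec σ K m) :
    lead ord g (monomial a c • u) = (ord.toSyn a : ord.syn) + lead ord g u := by
  classical
  rw [lead, proj_smul, ord.withBotDegree_mul, ord.withBotDegree_monomial, if_neg hc, map_add]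
  rfl

lemma lead_smul {c : K} (hc : c ≠ 0) (u : ModVec σ K m) :
    lead ord g (c • u) = lead ord g u := by
  rw [smul_eq_monomial_smul, lead_monomial_smul 0 hc]
  simp

lemma lead_monomial_smul_le_iff (a : σ →₀ ℕ) {c d : K} (hc : c ≠ 0) (hd : d ≠ 0)
    (u v : ModVec σ K m) :
    lead ord g (monomial a c • u) ≤ lead ord g (monomial a d • v) ↔
      lead ord g u ≤ lead ord g v := by
  rw [lead_monomial_smul a hc, lead_monomial_smul a hd]
  exact WithBot.add_le_add_iff_left WithBot.coe_ne_bot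

lemma lead_sub_of_lt {u v : ModVec σ K m} (h : lead ord g v < lead ord g u) :
    lead ord g (u - v) = lead ord g u := by
  rw [lead, proj_sub, sub_eq_add_neg, ord.withBotDegree_add_of_lt]
  · rfl
  · have hneg : ord.withBotDegree (-proj g v) = ord.withBotDegree (proj g v) := by
      rw [ord.withBotDegree_eq_withBotDegree_iff]
      simp
    rw [hneg]
    exact h

lemma lead_sub_lt {u v : ModVec σ K m} (hv : proj g v ≠ 0)
    (h : ord.leadingTerm (proj g v) = ord.leadingTerm (proj g u)) :
    lead ord g (u - v) < lead ord g u := by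
  rw [ord.leadingTerm_eq_leadingTerm_iff] at h
  have hu : proj g u ≠ 0 := by
    rw [← ord.leadingCoeff_ne_zero_iff, ← h.1]
    exact ord.leadingCoeff_ne_zero_iff.2 hv
  by_cases h0 : proj g (u - v) = 0
  · rw [lead_eq_bot_iff.2 h0, lead_eq_coe hu]
    exact WithBot.bot_lt_coe _
  rw [lead_eq_coe h0, lead_eq_coe hu, WithBot.coe_lt_coe]
  have hle := ord.degree_sub_le (f := proj g u) (g := proj g v)
  rw [← proj_sub, h.2, sup_idem] at hle
  refine lt_of_le_of_ne hle fun he => ?_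
  have hd := ord.toSyn.injective he
  have : ord.leadingCoeff (proj g (u - v)) = 0 := by
    have h1 := h.1
    simp only [MonomialOrder.leadingCoeff] at h1 ⊢
    rw [hd, proj_sub, coeff_sub, ← h1, h.2, sub_self]
  exact h0 (ord.leadingCoeff_eq_zero_iff.1 this)

/-- An element with the same lead monomial as `u` can be scaled to have the same lead term. -/
lemma exists_smul_cancelsLead {r u : ModVec σ K m} (hr : proj g r ≠ 0) (hu : proj g u ≠ 0)
    (h : lead ord g r = lead ord g u) : ∃ c : K, c ≠ 0 ∧ CancelsLead ord g (c • r) u := by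
  have hr' := ord.leadingCoeff_ne_zero_iff.2 hr
  have hu' := ord.leadingCoeff_ne_zero_iff.2 hu
  have hc := div_ne_zero hu' hr'
  refine ⟨_, hc, ?_, hu, ?_⟩
  · rw [Ne, ← lead_eq_bot_iff (ord := ord), lead_smul hc, lead_eq_bot_iff]
    exact hr
  · rw [lead_eq_lead_iff hr hu] at h
    rw [ord.leadingTerm_eq_leadingTerm_iff, proj_smul_scalar]
    have hdeg : ord.degree (C (ord.leadingCoeff (proj g u) / ord.leadingCoeff (proj g r)) *
        proj g r) = ord.degree (proj g r) := by
      rw [ord.degree_mul (by simpa using hc) hr, ord.degree_C, zero_add]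
    refine ⟨?_, hdeg.trans h⟩
    rw [MonomialOrder.leadingCoeff, hdeg, coeff_C_mul]
    exact div_mul_cancel₀ _ hr'

lemma CancelsLead.cancelsTerm {r u : ModVec σ K m} (h : CancelsLead ord g r u) :
    CancelsTerm ord g r u := by
  obtain ⟨h0, -, h2⟩ := h
  rw [ord.leadingTerm_eq_leadingTerm_iff] at h2
  refine ⟨h0, ?_⟩
  rw [h2.1, h2.2]
  rfl

lemma CancelsLead.lead_eq {r u : ModVec σ K m} (h : CancelsLead ord g r u) :
    lead ord g r = lead ord g u := by
  rw [lead_eq_lead_iff h.1 h.2.1]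
  exact (ord.leadingTerm_eq_leadingTerm_iff.1 h.2.2).2

lemma CancelsTerm.lead_le {r u : ModVec σ K m} (h : CancelsTerm ord g r u) :
    lead ord g r ≤ lead ord g u := by
  have hne : (proj g u).coeff (ord.degree (proj g r)) ≠ 0 := by
    rw [h.2]
    exact ord.leadingCoeff_ne_zero_iff.2 h.1
  have hu : proj g u ≠ 0 := by
    rintro h0
    simp [h0] at hne
  rw [lead_le_lead_iff h.1 hu]
  exact ord.le_degree (mem_support_iff.2 hne)

variable [LinearOrder (ModTerm σ m)]

lemma regTopReducible_iff {B : Set (ModVec σ K m)} {u : ModVec σ K m} (hu : proj g u ≠ 0) :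
    RegTopReducible ord g B u ↔ ∃ r ∈ multiples B, lead ord g r = lead ord g u ∧ sig r < sig u := by
  constructor
  · rintro ⟨r, hr, hc, hs⟩
    exact ⟨r, hr, hc.lead_eq, hs⟩
  · rintro ⟨r, hr, hl, hs⟩
    obtain ⟨c, hc, hcl⟩ := exists_smul_cancelsLead (proj_ne_zero_of_lead_eq hl hu) hu hl
    exact ⟨c • r, smul_mem_multiples hr hc, hcl, by rwa [sig_smul_scalar hc]⟩

lemma singTopReducible_iff {B : Set (ModVec σ K m)} {u : ModVec σ K m} (hu : proj g u ≠ 0) :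
    SingTopReducible ord g B u ↔ ∃ r ∈ multiples B, lead ord g r = lead ord g u ∧ sig r = sig u := by
  constructor
  · rintro ⟨r, hr, hc, hs⟩
    exact ⟨r, hr, hc.lead_eq, hs⟩
  · rintro ⟨r, hr, hl, hs⟩
    obtain ⟨c, hc, hcl⟩ := exists_smul_cancelsLead (proj_ne_zero_of_lead_eq hl hu) hu hl
    exact ⟨c • r, smul_mem_multiples hr hc, hcl, by rwa [sig_smul_scalar hc]⟩

/-- No element of the same signature as `u` has a smaller lead monomial. -/
def IsMin (ord : MonomialOrder σ) (g : Fin m → MvPolynomial σ K) (u : ModVec σ K m) : Prop :=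
  ∀ v : ModVec σ K m, sig v = sig u → lead ord g u ≤ lead ord g v

/-- `T` is the signature of a syzygy. -/
def IsSyzSig (g : Fin m → MvPolynomial σ K) (T : ModTerm σ m) : Prop :=
  ∃ u : ModVec σ K m, sig u = T ∧ proj g u = 0

/-- Some multiple of an element of `B` has signature `T` and the smallest lead monomial possible
for that signature. -/
def Covers (ord : MonomialOrder σ) (g : Fin m → MvPolynomial σ K) (B : Set (ModVec σ K m))
    (T : ModTerm σ m) : Prop :=
  ∃ r ∈ multiples B, sig r = T ∧ proj g r ≠ 0 ∧ IsMin ord g r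

lemma Covers.mono {B B' : Set (ModVec σ K m)} (h : B ⊆ B') {T : ModTerm σ m}
    (hT : Covers ord g B T) : Covers ord g B' T := by
  obtain ⟨r, hr, h'⟩ := hT
  exact ⟨r, multiples_mono h hr, h'⟩

lemma IsMin.congr {u v : ModVec σ K m} (h : IsMin ord g u) (hs : sig v = sig u)
    (hl : lead ord g v = lead ord g u) : IsMin ord g v := fun w hw =>
  hl ▸ h w (hw.trans hs)

lemma IsMin.lead_eq {u v : ModVec σ K m} (hu : IsMin ord g u) (hv : IsMin ord g v)
    (hs : sig u = sig v) : lead ord g u = lead ord g v :=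
  le_antisymm (hu v hs.symm) (hv u hs)

lemma IsMin.not_isSyzSig {u : ModVec σ K m} (hu : IsMin ord g u) {T : ModTerm σ m}
    (hs : sig u = T) (h0 : proj g u ≠ 0) : ¬ IsSyzSig g T := by
  rintro ⟨v, hv, hv0⟩
  have := hu v (hv.trans hs.symm)
  rw [lead_eq_bot_iff.2 hv0, le_bot_iff, lead_eq_bot_iff] at this
  exact h0 this

lemma Covers.not_isSyzSig {B : Set (ModVec σ K m)} {T : ModTerm σ m} (h : Covers ord g B T) :
    ¬ IsSyzSig g T := by
  obtain ⟨r, -, hs, h0, hm⟩ := h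
  exact hm.not_isSyzSig hs h0

/-- Lead monomials, together with `⊥` for syzygies, are well-ordered, and the term `T` itself
provides an element of signature `T`. -/
lemma exists_isMin (T : ModTerm σ m) :
    ∃ u : ModVec σ K m, sig u = T ∧ IsMin ord g u := by
  have : WellFounded (fun x y : WithBot ord.syn => x < y) := wellFounded_lt
  obtain ⟨u, hu, hmin⟩ := (InvImage.wf (lead ord g) this).has_min
    {u : ModVec σ K m | sig u = T} ⟨T.toVec K, sig_toVec T⟩
  exact ⟨u, hu, fun v hv => not_lt.1 (hmin v (hv.trans hu))⟩

/-- An element whose lead monomial is not smallest possible for its signature has a (not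
necessarily monomial) top reducer of smaller signature. -/
lemma exists_sig_lt_of_not_isMin {u : ModVec σ K m} {T : ModTerm σ m} (hs : sig u = T)
    (h : ¬ IsMin ord g u) :
    ∃ z : ModVec σ K m, sig z < T ∧ lead ord g z = lead ord g u := by
  simp only [IsMin, not_forall, not_le] at h
  obtain ⟨v, hv, hlt⟩ := h
  obtain ⟨c, hc, hlt'⟩ := exists_sig_sub_smul_lt hs (hv.trans hs)
  refine ⟨u - c • v, hlt', lead_sub_of_lt ?_⟩
  rwa [lead_smul hc]

/-- Subtracting a scalar multiple of `z` cancels the lead term of `u` without touching its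
signature. This is the converse of `exists_sig_lt_of_not_isMin`: together they say that a non-syzygy
is optimal iff no element of smaller signature shares its lead monomial. -/
lemma exists_lead_lt {u z : ModVec σ K m} (hz : sig z < sig u) (hu : proj g u ≠ 0)
    (hl : lead ord g z = lead ord g u) :
    ∃ v, sig v = sig u ∧ lead ord g v < lead ord g u := by
  obtain ⟨c, hc, hcl⟩ := exists_smul_cancelsLead (proj_ne_zero_of_lead_eq hl hu) hu hl
  refine ⟨u - c • z, sig_sub_of_lt ?_, lead_sub_lt hcl.1 hcl.2.2⟩
  rwa [sig_smul_scalar hc]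

lemma IsMin.not_sig_lt {u z : ModVec σ K m} (h : IsMin ord g u) (hu : proj g u ≠ 0)
    (hl : lead ord g z = lead ord g u) : ¬ sig z < sig u := by
  intro hz
  obtain ⟨v, hv, hlt⟩ := exists_lead_lt hz hu hl
  exact absurd (h v hv) (not_le.2 hlt)

lemma IsMin.not_regTopReducible {B : Set (ModVec σ K m)} {u : ModVec σ K m}
    (h : IsMin ord g u) : ¬ RegTopReducible ord g B u := by
  rintro ⟨r, -, hc, hs⟩
  exact h.not_sig_lt hc.2.1 hc.lead_eq hs

end Lead

/-! ### Optimality, syzygy signatures and monomial multiples -/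

section LeadOrder

variable {σ K : Type*} [Field K] {m : ℕ} [LinearOrder (ModTerm σ m)] {ord : MonomialOrder σ}
  {g : Fin m → MvPolynomial σ K}

namespace IsModTermOrder

variable (hord : IsModTermOrder (m := m) ord)
include hord

/-- A better competitor of `u`, multiplied by the same monomial, would beat the multiple of `u`. -/
lemma isMin_of_monomial_smul {a : σ →₀ ℕ} {c : K} (hc : c ≠ 0) {u : ModVec σ K m}
    (h : IsMin ord g (monomial a c • u)) : IsMin ord g u := by
  intro v hv
  refine (lead_monomial_smul_le_iff a hc hc u v).1 (h _ ?_)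
  rw [hord.sig_monomial_smul a hc, hord.sig_monomial_smul a hc, hv]

lemma isSyzSig_shift {T : ModTerm σ m} (h : IsSyzSig g T) (a : σ →₀ ℕ) :
    IsSyzSig g (T.shift a) := by
  obtain ⟨u, hu, h0⟩ := h
  refine ⟨(monomial a 1 : MvPolynomial σ K) • u, ?_, by rw [proj_smul, h0, mul_zero]⟩
  rw [hord.sig_monomial_smul a one_ne_zero, hu]
  rfl

lemma isSyzSig_of_divides {S T : ModTerm σ m} (h : IsSyzSig g S) (hd : S.Divides T) :
    IsSyzSig g T := by
  obtain ⟨a, rfl⟩ := hd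
  exact hord.isSyzSig_shift h a

lemma exists_sig_of_sig_monomial_smul {a : σ →₀ ℕ} {c : K} (hc : c ≠ 0) {u : ModVec σ K m}
    {T : ModTerm σ m} (h : sig (monomial a c • u) = T) :
    ∃ S : ModTerm σ m, sig u = S ∧ T = S.shift a := by
  rw [hord.sig_monomial_smul a hc] at h
  rcases hu : sig u with _ | S
  · rw [hu] at h
    exact absurd h.symm (WithBot.coe_ne_bot)
  · rw [hu] at h
    exact ⟨S, rfl, (WithBot.coe_injective h).symm⟩

/-- The initial submodule of the syzygies consists of the elements all of whose terms are
signatures of syzygies. -/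
lemma toVec_mem_initialSyz_iff {T : ModTerm σ m} :
    T.toVec K ∈ initialSyz g ↔ IsSyzSig g T := by
  constructor
  · intro h
    -- For the span induction the claim has to be about all terms of an arbitrary element: that
    -- property survives sums and polynomial multiples.
    have key : ∀ v ∈ initialSyz g, ∀ S, mcoeff v S ≠ 0 → IsSyzSig g S := by
      intro v hv
      induction hv using Submodule.span_induction with
      | mem v hv =>
        obtain ⟨u, T, h0, hs, rfl⟩ := hv
        intro S hS
        rw [(mcoeff_toVec T S).1 hS]
        exact ⟨u, hs, h0⟩
      | zero => exact fun S hS => absurd (by simp [mcoeff]) hS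
      | add x y _ _ hx hy =>
        intro S hS
        rw [mcoeff_add] at hS
        by_cases h : mcoeff x S = 0
        · exact hy S fun h' => hS (by simp [h, h'])
        · exact hx S h
      | smul p x _ hx =>
        intro S hS
        obtain ⟨a, -, S', hS', rfl⟩ := exists_shift_of_mcoeff_smul_ne_zero hS
        exact hord.isSyzSig_shift (hx S' hS') a
    exact key _ h T ((mcoeff_toVec T T).2 rfl)
  · rintro ⟨u, hs, h0⟩
    exact Submodule.subset_span ⟨u, T, h0, hs, rfl⟩

lemma mem_minGens_initialSyz_iff {T : ModTerm σ m} :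
    T ∈ minGens (initialSyz g) ↔
      IsSyzSig g T ∧ ∀ L : ModTerm σ m, IsSyzSig g L → L.Divides T → L = T := by
  simp only [minGens, Set.mem_ofPred_eq, hord.toVec_mem_initialSyz_iff]

end IsModTermOrder

end LeadOrder

/-! ### Signature Gröbner bases through covered signatures -/

section GroebnerBases

variable {σ K : Type*} [Field K] {m : ℕ} [LinearOrder (ModTerm σ m)] {ord : MonomialOrder σ}
  {g : Fin m → MvPolynomial σ K}

omit [LinearOrder (ModTerm σ m)] in
lemma proj_ne_zero_of_mem_multiples {B : Set (ModVec σ K m)} (hB : ∀ β ∈ B, proj g β ≠ 0)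
    {r : ModVec σ K m} (hr : r ∈ multiples B) : proj g r ≠ 0 := by
  obtain ⟨β, hβ, a, c, hc, rfl⟩ := hr
  rw [proj_smul]
  exact mul_ne_zero (by simpa using hc) (hB β hβ)

/-- `T` is the signature of a nonsyzygy, and an element of signature `T` with smallest possible
lead monomial is never a proper multiple of another element. -/
def IsPrimSig (ord : MonomialOrder σ) (g : Fin m → MvPolynomial σ K) (T : ModTerm σ m) : Prop :=
  ¬ IsSyzSig g T ∧ ∀ (a : σ →₀ ℕ) (β : ModVec σ K m),
    sig ((monomial a 1 : MvPolynomial σ K) • β) = T →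
      IsMin ord g ((monomial a 1 : MvPolynomial σ K) • β) → a = 0

/-- The signatures in which a minimal signature Gröbner basis has an additional element. -/
def IsNewSig (ord : MonomialOrder σ) (g : Fin m → MvPolynomial σ K) (T : ModTerm σ m) : Prop :=
  IsPrimSig ord g T ∧ ¬ ∃ i, sig (unit σ K i) = (T : WithBot (ModTerm σ m)) ∧
    IsMin ord g (unit σ K i)

namespace IsModTermOrder

variable (hord : IsModTermOrder (m := m) ord)
include hord

lemma sig_monomial_smul_congr (a : σ →₀ ℕ) {c d : K} (hc : c ≠ 0) (hd : d ≠ 0)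
    {u v : ModVec σ K m} (h : sig u = sig v) :
    sig (monomial a c • u) = sig (monomial a d • v) := by
  rw [hord.sig_monomial_smul a hc, hord.sig_monomial_smul a hd, h]

lemma strictMono_map_shift (a : σ →₀ ℕ) :
    StrictMono (WithBot.map (ModTerm.shift a : ModTerm σ m → ModTerm σ m)) :=
  (hord.strictMono_shift a).withBot_map

/-- Signature and lead monomial of a monomial multiple depend only on those of the factor, so `γ`
can replace `β` without losing optimality. -/
lemma covers_of_sig_lead_eq {B : Set (ModVec σ K m)} {β γ : ModVec σ K m} {T : ModTerm σ m}
    {a : σ →₀ ℕ} {c : K} (hc : c ≠ 0) (hT : ¬ IsSyzSig g T) (hs : sig (monomial a c • β) = T)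
    (hmin : IsMin ord g (monomial a c • β)) (hγ : γ ∈ multiples B) (hsig : sig γ = sig β)
    (hlead : lead ord g γ = lead ord g β) : Covers ord g B T := by
  have h1 := (hord.sig_monomial_smul_congr a hc hc hsig).trans hs
  refine ⟨_, monomial_smul_mem_multiples hγ a hc, h1, fun h0 => hT ⟨_, h1, h0⟩,
    hmin.congr (h1.trans hs.symm) ?_⟩
  rw [lead_monomial_smul a hc, lead_monomial_smul a hc, hlead]

/-- Primitivity forces the monomial of a covering multiple to be constant, so the basis element
itself already has signature `T` and is optimal. -/
lemma exists_mem_of_covers {B : Set (ModVec σ K m)} {T : ModTerm σ m} (hT : IsPrimSig ord g T)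
    (h : Covers ord g B T) : ∃ β ∈ B, sig β = T ∧ IsMin ord g β := by
  obtain ⟨r, ⟨β, hβ, a, c, hc, rfl⟩, hs, h0, hmin⟩ := h
  have hs' : sig ((monomial a 1 : MvPolynomial σ K) • β) = sig (monomial a c • β) :=
    hord.sig_monomial_smul_congr a one_ne_zero hc rfl
  have ha := hT.2 a β (hs'.trans hs) (hmin.congr hs' (by
    rw [lead_monomial_smul a hc, lead_monomial_smul a one_ne_zero]))
  refine ⟨β, hβ, ?_, hord.isMin_of_monomial_smul hc hmin⟩
  subst ha
  rwa [← smul_eq_monomial_smul, sig_smul_scalar hc] at hs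

variable [Finite σ]

/-- Well-founded descent: if `T` is not primitive, an optimal element of signature `T` is a proper
multiple of an optimal element of strictly smaller signature, and the multipliers found on the way
down compose. -/
lemma exists_isPrimSig {T : ModTerm σ m} (hT : ¬ IsSyzSig g T) :
    ∃ (S : ModTerm σ m) (u : ModVec σ K m) (a : σ →₀ ℕ), IsPrimSig ord g S ∧ sig u = S ∧
      IsMin ord g u ∧ sig ((monomial a 1 : MvPolynomial σ K) • u) = T ∧
      IsMin ord g ((monomial a 1 : MvPolynomial σ K) • u) := by
  have := hord.wellFoundedLT
  induction T using WellFoundedLT.induction with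
  | ind T ih =>
  by_cases hp : IsPrimSig ord g T
  · obtain ⟨u, hu, hmin⟩ := exists_isMin (K := K) (ord := ord) (g := g) T
    have h1 : (monomial (0 : σ →₀ ℕ) 1 : MvPolynomial σ K) • u = u := by
      rw [← smul_eq_monomial_smul, one_smul]
    exact ⟨T, u, 0, hp, hu, hmin, by rwa [h1], by rwa [h1]⟩
  · simp only [IsPrimSig, not_and, not_forall] at hp
    obtain ⟨a, β, hs, hmin, ha⟩ := hp hT
    obtain ⟨S, hS, rfl⟩ := hord.exists_sig_of_sig_monomial_smul one_ne_zero hs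
    have hlt : S < S.shift a := by
      have := hord.shift_lt_shift_left (a := 0) (b := a)
        (by rw [map_zero, MonomialOrder.toSyn_lt_iff_ne_zero, Ne, ord.toSyn_eq_zero_iff]
            exact ha) S
      rwa [S.shift_zero] at this
    obtain ⟨S', u, b, hS', hu, humin, hbs, hbmin⟩ :=
      ih S hlt fun h => hT (hord.isSyzSig_shift h a)
    have hβ := hord.isMin_of_monomial_smul one_ne_zero hmin
    have hl := hbmin.lead_eq hβ (hbs.trans hS.symm)
    have h1 := hord.sig_monomial_smul_congr a (one_ne_zero (α := K)) one_ne_zero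
      (hbs.trans hS.symm)
    have h2 : (monomial (a + b) 1 : MvPolynomial σ K) • u =
        (monomial a 1 : MvPolynomial σ K) • (monomial b 1 : MvPolynomial σ K) • u := by
      rw [smul_smul, monomial_mul, one_mul]
    refine ⟨S', u, a + b, hS', hu, humin, ?_, ?_⟩
    · rw [h2]
      exact h1.trans hs
    · rw [h2]
      refine hmin.congr h1 ?_
      rw [lead_monomial_smul a one_ne_zero, lead_monomial_smul a one_ne_zero, hl]

/-- An optimal element in signature `T` can be chosen as a multiple of one in a primitive signature,
and a primitive signature is either new or served by an `e_i`. -/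
lemma covers_of_isNewSig {B : Set (ModVec σ K m)} (hu : Set.range (unit σ K) ⊆ B)
    (hB : ∀ T, IsNewSig ord g T → ∃ β ∈ B, sig β = T ∧ IsMin ord g β) {T : ModTerm σ m}
    (hT : ¬ IsSyzSig g T) : Covers ord g B T := by
  obtain ⟨S, u, a, hS, hus, humin, hs, hmin⟩ := hord.exists_isPrimSig (ord := ord) (g := g) hT
  obtain ⟨β, hβ, hβs, hβmin⟩ : ∃ β ∈ B, sig β = S ∧ IsMin ord g β := by
    by_cases h : ∃ i, sig (unit σ K i) = (S : WithBot (ModTerm σ m)) ∧ IsMin ord g (unit σ K i)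
    · obtain ⟨i, hi⟩ := h
      exact ⟨_, hu ⟨i, rfl⟩, hi⟩
    · exact hB S ⟨hS, h⟩
  exact hord.covers_of_sig_lead_eq one_ne_zero hT hs hmin (mem_multiples_self hβ)
    (hβs.trans hus.symm) (hβmin.lead_eq humin (hβs.trans hus.symm))

/-- Induction on the signature of `z`. If `z` is optimal, the covering multiple has the same lead
monomial; otherwise `z` is replaced by an element of smaller signature with the same lead monomial.
-/
lemma exists_reducer {B : Set (ModVec σ K m)} {z : ModVec σ K m}
    (hB : ∀ T : ModTerm σ m, T ≤ sig z → IsSyzSig g T ∨ Covers ord g B T) (hz : proj g z ≠ 0) :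
    ∃ r ∈ multiples B, lead ord g r = lead ord g z ∧ sig r ≤ sig z := by
  have := hord.wellFoundedLT
  have hwf : WellFounded (fun x y : WithBot (ModTerm σ m) => x < y) := wellFounded_lt
  induction z using (InvImage.wf sig hwf).induction with
  | _ z ih =>
  obtain ⟨T, hT⟩ : ∃ T : ModTerm σ m, sig z = T := by
    rcases h : sig z with _ | T
    · rw [sig_eq_bot_iff.1 h] at hz
      simp [proj] at hz
    · exact ⟨T, rfl⟩
  by_cases hmin : IsMin ord g z
  · rcases hB T hT.ge with h | ⟨r, hr, hs, -, hrm⟩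
    · exact absurd h (hmin.not_isSyzSig hT hz)
    · exact ⟨r, hr, hrm.lead_eq hmin (hs.trans hT.symm), (hs.trans hT.symm).le⟩
  · obtain ⟨y, hy, hl⟩ := exists_sig_lt_of_not_isMin hT hmin
    rw [← hT] at hy
    obtain ⟨r, hr, hrl, hrs⟩ := ih y hy (fun S hS => hB S (hS.trans hy.le))
      (proj_ne_zero_of_lead_eq hl hz)
    exact ⟨r, hr, hrl.trans hl, hrs.trans hy.le⟩

omit hord [Finite σ] in
-- The lead monomial of `u` survives until some step uses a reducer with exactly that lead monomial,
-- and it must disappear before a syzygy is reached.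
lemma exists_multiple_of_sReducesToZero {B : Set (ModVec σ K m)} {u : ModVec σ K m}
    (h : SReducesToZero ord g B u) (hu : proj g u ≠ 0) :
    ∃ r ∈ multiples B, lead ord g r = lead ord g u ∧ sig r ≤ sig u := by
  obtain ⟨v, hv, hv0⟩ := h
  have key : (∃ r ∈ multiples B, lead ord g r = lead ord g u ∧ sig r ≤ sig u) ∨
      lead ord g v = lead ord g u := by
    clear hv0
    induction hv with
    | refl => exact Or.inr rfl
    | tail _ hst ih =>
      refine ih.elim Or.inl fun ih => ?_
      obtain ⟨r, hr, hc, hs, rfl⟩ := hst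
      rcases hc.lead_le.lt_or_eq with h | h
      · exact Or.inr ((lead_sub_of_lt h).trans ih)
      · exact Or.inl ⟨r, hr, h.trans ih, hs⟩
  refine key.resolve_right fun h => hu ?_
  rwa [lead_eq_bot_iff.2 hv0, eq_comm, lead_eq_bot_iff] at h

/-- Reducing an optimal non-syzygy requires a reducer with its lead monomial; by optimality this
reducer cannot have smaller signature, so it covers `T`. Conversely, `exists_reducer` allows top
reduction to continue until a syzygy is reached. -/
lemma isSigGB_iff {B : Set (ModVec σ K m)} :
    IsSigGB ord g B ↔ ∀ T, IsSyzSig g T ∨ Covers ord g B T := by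
  constructor
  · intro h T
    by_cases hT : IsSyzSig g T
    · exact Or.inl hT
    obtain ⟨u, hu, hmin⟩ := exists_isMin (K := K) (ord := ord) (g := g) T
    have hu0 : proj g u ≠ 0 := fun h0 => hT ⟨u, hu, h0⟩
    obtain ⟨r, hr, hl, hs⟩ := exists_multiple_of_sReducesToZero (h u) hu0
    have hs' := hs.eq_of_not_lt (hmin.not_sig_lt hu0 hl)
    exact Or.inr ⟨r, hr, hs'.trans hu, proj_ne_zero_of_lead_eq hl hu0, hmin.congr hs' hl⟩
  · intro h u
    have hwf : WellFounded (fun x y : WithBot ord.syn => x < y) := wellFounded_lt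
    -- The bound `S` stays fixed during the induction on the lead monomial, since the signature of
    -- the intermediate elements may drop.
    have key : ∀ (S : WithBot (ModTerm σ m)) (v : ModVec σ K m), sig v ≤ S →
        ∃ r, Relation.ReflTransGen (SStep ord g B S) v r ∧ proj g r = 0 := by
      intro S v
      induction v using (InvImage.wf (lead ord g) hwf).induction with
      | _ v ih =>
      intro hv
      by_cases hv0 : proj g v = 0
      · exact ⟨v, .refl, hv0⟩
      obtain ⟨r, hr, hl, hs⟩ := hord.exists_reducer (fun T _ => h T) hv0
      obtain ⟨c, hc, hcl⟩ := exists_smul_cancelsLead (proj_ne_zero_of_lead_eq hl hv0) hv0 hl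
      have hs' : sig (c • r) ≤ S := by
        rw [sig_smul_scalar hc]
        exact hs.trans hv
      obtain ⟨y, hy, hy0⟩ := ih (v - c • r) (lead_sub_lt hcl.1 hcl.2.2)
        ((sig_sub_le _ _).trans (sup_le hv hs'))
      exact ⟨y, .head ⟨c • r, smul_mem_multiples hr hc, hcl.cancelsTerm, hs', rfl⟩ hy, hy0⟩
    exact key _ u le_rfl

lemma isSigGB_extension_iff {k : ℕ} {w : Fin k → ModVec σ K m} {J : Set (Fin k)} :
    IsSigGB ord g (extension w J) ↔
      ∀ T, IsNewSig ord g T → ∃ j ∈ J, sig (w j) = T ∧ IsMin ord g (w j) := by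
  rw [hord.isSigGB_iff]
  constructor
  · intro h T hT
    obtain ⟨β, hβ, hs, hmin⟩ := hord.exists_mem_of_covers hT.1 ((h T).resolve_left hT.1.1)
    rcases hβ with ⟨i, rfl⟩ | ⟨j, hj, rfl⟩
    · exact absurd ⟨i, hs, hmin⟩ hT.2
    · exact ⟨j, hj, hs, hmin⟩
  · intro h T
    refine or_iff_not_imp_left.2 fun hT => hord.covers_of_isNewSig Set.subset_union_left ?_ hT
    intro S hS
    obtain ⟨j, hj, hjs⟩ := h S hS
    exact ⟨w j, Or.inr ⟨j, hj, rfl⟩, hjs⟩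

/-- The additional elements of a minimal signature Gröbner basis have pairwise distinct
signatures, namely those of `IsNewSig`. -/
lemma sig_of_isMinimalSigGB {k : ℕ} {w : Fin k → ModVec σ K m}
    (hw : IsMinimalSigGB ord g w) :
    Function.Injective (fun j => sig (w j)) ∧
    (∀ j, ∃ T, IsNewSig ord g T ∧ sig (w j) = T ∧ IsMin ord g (w j)) ∧
    ∀ T, IsNewSig ord g T → ∃ j, sig (w j) = T := by
  have h := hord.isSigGB_extension_iff.1 hw.isSigGB
  choose f _ hfs hfm using h
  -- One chosen index per new signature already gives a signature Gröbner basis, so by minimality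
  -- there are no other indices.
  have hJ : {j | ∃ T hT, j = f T hT} = Set.univ := by
    refine hw.minimal _ (hord.isSigGB_extension_iff.2 fun T hT => ?_)
    exact ⟨f T hT, ⟨T, hT, rfl⟩, hfs T hT, hfm T hT⟩
  have hall : ∀ j, ∃ T hT, j = f T hT := fun j => by
    have : j ∈ {j | ∃ T hT, j = f T hT} := hJ ▸ Set.mem_univ j
    exact this
  refine ⟨fun i j hij => ?_, fun j => ?_, fun T hT => ⟨_, hfs T hT⟩⟩
  · obtain ⟨S, hS, rfl⟩ := hall i
    obtain ⟨T, hT, rfl⟩ := hall j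
    simp only [hfs, WithBot.coe_inj] at hij
    subst hij
    rfl
  · obtain ⟨T, hT, rfl⟩ := hall j
    exact ⟨T, hT, hfs T hT, hfm T hT⟩

end IsModTermOrder

end GroebnerBases

/-! ### Regular reduction and its termination -/

section RegularReduction

variable {σ K : Type*} [Field K] {m : ℕ} [LinearOrder (ModTerm σ m)] {ord : MonomialOrder σ}
  {g : Fin m → MvPolynomial σ K} {B : Set (ModVec σ K m)}

lemma RegReducesTo.sig_eq {u v : ModVec σ K m} (h : RegReducesTo ord g B u v) :
    sig v = sig u := by
  obtain ⟨h, -⟩ := h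
  induction h with
  | refl => rfl
  | tail _ hst ih =>
    obtain ⟨r, -, -, hs, rfl⟩ := hst
    rw [sig_sub_of_lt hs, ih]

lemma RegReducesTo.not_regTopReducible {u v : ModVec σ K m} (h : RegReducesTo ord g B u v) :
    ¬ RegTopReducible ord g B v := by
  rintro ⟨r, hr, hc, hs⟩
  exact h.2 ⟨_, r, hr, hc.cancelsTerm, hs, rfl⟩

/-- Regular reduction terminates for a suitable choice of reducers. -/
lemma exists_regReducesTo (B : Set (ModVec σ K m)) (u : ModVec σ K m) :
    ∃ v, RegReducesTo ord g B u v := by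
  classical
  let P : WithBot (ModTerm σ m) → (σ →₀ ℕ) → Prop := fun T d =>
    ∃ r ∈ multiples B, proj g r ≠ 0 ∧ ord.degree (proj g r) = d ∧ sig r < T
  -- The measure is the largest reducible monomial of the polynomial. Always reducing at that
  -- monomial changes only it and smaller ones, and the set of reducible monomials is fixed because
  -- regular steps keep the signature.
  let μ : ModVec σ K m → WithBot ord.syn := fun u =>
    ((proj g u).support.filter (P (sig u))).sup fun d => ((ord.toSyn d : ord.syn) : WithBot ord.syn)
  have hwf : WellFounded (fun x y : WithBot ord.syn => x < y) := wellFounded_lt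
  induction u using (InvImage.wf μ hwf).induction with
  | _ u ih =>
  by_cases hirr : ∃ z, RegStep ord g B u z
  · have hne : ((proj g u).support.filter (P (sig u))).Nonempty := by
      obtain ⟨-, r, hr, hc, hs, -⟩ := hirr
      refine ⟨ord.degree (proj g r), Finset.mem_filter.2 ⟨?_, r, hr, hc.1, rfl, hs⟩⟩
      rw [mem_support_iff, hc.2]
      exact ord.leadingCoeff_ne_zero_iff.2 hc.1
    obtain ⟨d, hd, hmax⟩ := Finset.exists_max_image _ (fun d => ord.toSyn d) hne
    obtain ⟨hdu, r, hr, hr0, hrd, hs⟩ := Finset.mem_filter.1 hd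
    have hlc := ord.leadingCoeff_ne_zero_iff.2 hr0
    have hc : (proj g u).coeff d / ord.leadingCoeff (proj g r) ≠ 0 :=
      div_ne_zero (mem_support_iff.1 hdu) hlc
    set c := (proj g u).coeff d / ord.leadingCoeff (proj g r) with hcdef
    have hdeg : ord.degree (proj g (c • r)) = d := by
      rw [proj_smul_scalar, ord.degree_mul (by simpa using hc) hr0, ord.degree_C, zero_add, hrd]
    have hlcc : ord.leadingCoeff (proj g (c • r)) = (proj g u).coeff d := by
      rw [MonomialOrder.leadingCoeff, hdeg, proj_smul_scalar, coeff_C_mul, ← hrd]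
      rw [hcdef, hrd]
      simp only [MonomialOrder.leadingCoeff] at hlc ⊢
      rw [hrd] at hlc ⊢
      exact div_mul_cancel₀ _ hlc
    have hct : CancelsTerm ord g (c • r) u := by
      refine ⟨?_, by rw [hdeg, hlcc]⟩
      rw [← ord.leadingCoeff_ne_zero_iff, hlcc]
      exact mem_support_iff.1 hdu
    have hs' : sig (c • r) < sig u := by rwa [sig_smul_scalar hc]
    have hstep : RegStep ord g B u (u - c • r) := ⟨_, smul_mem_multiples hr hc, hct, hs', rfl⟩
    have hlt : μ (u - c • r) < μ u := by
      have hle : ((ord.toSyn d : ord.syn) : WithBot ord.syn) ≤ μ u :=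
        Finset.le_sup (f := fun d => ((ord.toSyn d : ord.syn) : WithBot ord.syn)) hd
      refine lt_of_lt_of_le ?_ hle
      simp only [μ]
      rw [Finset.sup_lt_iff (WithBot.bot_lt_coe _)]
      intro e he
      rw [WithBot.coe_lt_coe]
      rw [sig_sub_of_lt hs', Finset.mem_filter, mem_support_iff, proj_sub, coeff_sub] at he
      by_contra hle
      rcases (not_lt.1 hle).lt_or_eq with hlt | heq
      · have h0 : (proj g (c • r)).coeff e = 0 := ord.coeff_eq_zero_of_lt (by rwa [hdeg])
        rw [h0, sub_zero] at he
        exact absurd (hmax e (Finset.mem_filter.2 ⟨mem_support_iff.2 he.1, he.2⟩)) (not_le.2 hlt)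
      · have := ord.toSyn.injective heq
        subst this
        refine he.1 ?_
        rw [← hlcc, MonomialOrder.leadingCoeff, hdeg, sub_self]
    obtain ⟨v, hv, hv'⟩ := ih _ hlt
    exact ⟨v, .head hstep hv, hv'⟩
  · exact ⟨u, .refl, hirr⟩

end RegularReduction

/-! ### S-pairs, Koszul syzygies and a Buchberger criterion by signature -/

section SPairs

variable {σ K : Type*} [Field K] {m : ℕ} {ord : MonomialOrder σ} {g : Fin m → MvPolynomial σ K}

lemma cofactor_ne_zero (α : ModVec σ K m) {β : ModVec σ K m} (hβ : proj g β ≠ 0) :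
    cofactor ord g α β ≠ 0 := by
  simpa [cofactor] using hβ

/-- A common multiple of two monomials is a multiple of their lcm; `e` is the quotient. -/
lemma exists_cofactor_exponent {a b x y : σ →₀ ℕ} (h : a + x = b + y) :
    ∃ e, a = e + (y - x ⊓ y) ∧ b = e + (x - y ⊓ x) := by
  refine ⟨a - (y - x ⊓ y), ?_, ?_⟩ <;>
  · ext i
    have := DFunLike.congr_fun h i
    simp only [Finsupp.coe_add, Pi.add_apply, Finsupp.coe_tsub, Pi.sub_apply,
      Finsupp.inf_apply] at this ⊢
    omega

lemma leadingTerm_cofactor_mul {α β : ModVec σ K m} :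
    ord.leadingTerm (cofactor ord g α β * proj g α) =
      ord.leadingTerm (cofactor ord g β α * proj g β) := by
  have h : ord.degree (proj g β) - ord.degree (proj g α) ⊓ ord.degree (proj g β) +
      ord.degree (proj g α) = ord.degree (proj g α) -
        ord.degree (proj g β) ⊓ ord.degree (proj g α) + ord.degree (proj g β) := by
    ext i
    simp only [Finsupp.coe_add, Pi.add_apply, Finsupp.coe_tsub, Pi.sub_apply, Finsupp.inf_apply]
    omega
  rw [ord.leadingTerm_mul, ord.leadingTerm_mul]
  simp only [cofactor, MonomialOrder.leadingTerm_monomial]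
  simp only [MonomialOrder.leadingTerm, monomial_mul]
  rw [h, mul_comm]

variable [LinearOrder (ModTerm σ m)]

lemma RegularSPair.symm {α β : ModVec σ K m} (h : RegularSPair ord g α β) :
    RegularSPair ord g β α := Ne.symm h

lemma RegularSPair.sig_spair {α β : ModVec σ K m} (h : RegularSPair ord g α β) :
    sig (spair ord g α β) = sig (cofactor ord g α β • α) ⊔ sig (cofactor ord g β α • β) :=
  sig_sub_of_ne h

lemma not_regularSPair_self (α : ModVec σ K m) : ¬ RegularSPair ord g α α := fun h => h rfl

lemma sig_spair_comm (α β : ModVec σ K m) : sig (spair ord g α β) = sig (spair ord g β α) :=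
  sig_sub_comm _ _

lemma RegularSPair.exists_sig {α β : ModVec σ K m} (h : RegularSPair ord g α β) :
    ∃ T : ModTerm σ m, sig (spair ord g α β) = T := by
  rcases hs : sig (spair ord g α β) with _ | T
  · have h' := h.sig_spair
    rw [hs] at h'
    obtain ⟨h1, h2⟩ := (sup_eq_bot_iff.1 h'.symm)
    exact absurd (h1.trans h2.symm) h
  · exact ⟨T, rfl⟩

namespace IsModTermOrder

variable (hord : IsModTermOrder (m := m) ord)
include hord

/-- A regular top reduction of a multiple of `α` by a multiple of `β` is a multiple of the regular
S-pair of `α` and `β`. -/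
lemma exists_spair {α β : ModVec σ K m} (hα : proj g α ≠ 0) (hβ : proj g β ≠ 0)
    {a b : σ →₀ ℕ} {c d : K} (hc : c ≠ 0) (hd : d ≠ 0) {T : ModTerm σ m}
    (hs : sig (monomial a c • α) = T)
    (hl : lead ord g (monomial b d • β) = lead ord g (monomial a c • α))
    (hlt : sig (monomial b d • β) < sig (monomial a c • α)) :
    RegularSPair ord g α β ∧ ∃ (S : ModTerm σ m) (e : σ →₀ ℕ), sig (spair ord g α β) = S ∧
      T = S.shift e ∧
      ∀ r : ModVec σ K m, lead ord g r ≤ lead ord g (spair ord g α β) →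
        lead ord g ((monomial e 1 : MvPolynomial σ K) • r) < lead ord g (monomial a c • α) := by
  have hα' := ord.leadingCoeff_ne_zero_iff.2 hα
  have hβ' := ord.leadingCoeff_ne_zero_iff.2 hβ
  have hab : a + ord.degree (proj g α) = b + ord.degree (proj g β) := by
    rw [lead_monomial_smul b hd, lead_monomial_smul a hc, lead_eq_coe hα, lead_eq_coe hβ,
      ← WithBot.coe_add, ← WithBot.coe_add, WithBot.coe_inj, ← map_add, ← map_add] at hl
    exact (ord.toSyn.injective hl).symm
  obtain ⟨e, hea, heb⟩ := exists_cofactor_exponent hab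
  have h1 : ∀ c : K, c ≠ 0 → sig (monomial a c • α) =
      (sig (cofactor ord g α β • α)).map (ModTerm.shift e) := by
    intro c hc
    rw [cofactor, ← hord.sig_monomial_smul e (one_ne_zero (α := K)), smul_smul, monomial_mul,
      ← hea]
    exact hord.sig_monomial_smul_congr a hc (mul_ne_zero one_ne_zero hβ') rfl
  have h2 : sig (monomial b d • β) =
      (sig (cofactor ord g β α • β)).map (ModTerm.shift e) := by
    rw [cofactor, ← hord.sig_monomial_smul e (one_ne_zero (α := K)), smul_smul, monomial_mul,
      ← heb]
    exact hord.sig_monomial_smul_congr b hd (mul_ne_zero one_ne_zero hα') rfl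
  have hlt' : sig (cofactor ord g β α • β) < sig (cofactor ord g α β • α) := by
    rwa [h1 c hc, h2, (hord.strictMono_map_shift e).lt_iff_lt] at hlt
  have hsp : sig (spair ord g α β) = sig (cofactor ord g α β • α) := sig_sub_of_lt hlt'
  rw [h1 c hc] at hs
  refine ⟨hlt'.ne', ?_⟩
  rcases hS : sig (cofactor ord g α β • α) with _ | S
  · rw [hS] at hs
    exact absurd hs.symm WithBot.coe_ne_bot
  refine ⟨S, e, hsp.trans hS, ?_, fun r hr => ?_⟩
  · rw [hS] at hs
    exact (WithBot.coe_injective hs).symm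
  -- The lead terms of the two summands cancel in the S-pair.
  · have hcof : lead ord g (spair ord g α β) < lead ord g (cofactor ord g α β • α) := by
      refine lead_sub_lt ?_ ?_
      · rw [proj_smul]
        exact mul_ne_zero (cofactor_ne_zero β hα) hβ
      · rw [proj_smul, proj_smul]
        exact leadingTerm_cofactor_mul.symm
    have hmul : lead ord g (monomial a c • α) =
        lead ord g ((monomial e 1 : MvPolynomial σ K) • cofactor ord g α β • α) := by
      rw [cofactor, smul_smul, monomial_mul, ← hea, lead_monomial_smul a hc,
        lead_monomial_smul a (mul_ne_zero one_ne_zero hβ')]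
    rw [hmul, ← not_le, lead_monomial_smul_le_iff e one_ne_zero one_ne_zero, not_le]
    exact hr.trans_lt hcof

/-- For relatively prime lead terms each cofactor is the full lead term of the other polynomial, and
only the lead term of a multiplier affects a signature. -/
lemma sig_koszul_eq_sig_spair {α β : ModVec σ K m} (hα : proj g α ≠ 0) (hβ : proj g β ≠ 0)
    (hreg : RegularSPair ord g α β) (hrel : RelPrime ord g α β) :
    sig (proj g β • α) ≠ sig (proj g α • β) ∧ sig (koszul g α β) = sig (spair ord g α β) := by
  have key : ∀ α β : ModVec σ K m, proj g β ≠ 0 → RelPrime ord g α β →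
      sig (proj g β • α) = sig (cofactor ord g α β • α) := by
    intro α β hβ h
    rw [hord.sig_smul hβ, cofactor, hord.sig_monomial_smul _ (ord.leadingCoeff_ne_zero_iff.2 hβ),
      h, tsub_zero]
  have h1 := key α β hβ hrel
  have h2 := key β α hα (by rwa [RelPrime, inf_comm])
  have hne : sig (proj g β • α) ≠ sig (proj g α • β) := by rwa [h1, h2]
  refine ⟨hne, ?_⟩
  rw [hreg.sig_spair, koszul, sig_sub_of_ne hne, h1, h2]

omit hord in
lemma isSyzSig_of_isKoszulSig {B : Set (ModVec σ K m)} {T : ModTerm σ m}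
    (h : IsKoszulSig g B T) : IsSyzSig g T := by
  obtain ⟨α, -, β, -, -, hs⟩ := h
  exact ⟨_, hs, by rw [koszul, proj_sub, proj_smul, proj_smul, mul_comm, sub_self]⟩

/-- A regular Koszul signature depends only on the signatures and lead monomials of the two
elements, and neither element can have signature above `T`. This permits comparing two different
bases, even when they agree only up to `T`. -/
lemma isKoszulSig_congr {B B' : Set (ModVec σ K m)} (hB : ∀ β ∈ B, proj g β ≠ 0) {T : ModTerm σ m}
    (hBB' : ∀ β ∈ B, sig β ≤ T → ∃ γ ∈ B', sig γ = sig β ∧ lead ord g γ = lead ord g β)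
    (h : IsKoszulSig g B T) : IsKoszulSig g B' T := by
  obtain ⟨α, hα, β, hβ, hne, hs⟩ := h
  rw [koszul, sig_sub_of_ne hne] at hs
  have hle : ∀ (p : MvPolynomial σ K) (u : ModVec σ K m), p ≠ 0 → sig u ≤ sig (p • u) := by
    intro p u hp
    rw [hord.sig_smul hp]
    rcases sig u with _ | S
    · exact bot_le
    · exact WithBot.coe_le_coe.2 (hord.le_shift _ S)
  obtain ⟨α', hα', hsα, hlα⟩ := hBB' α hα ((hle _ α (hB β hβ)).trans (le_sup_left.trans hs.le))
  obtain ⟨β', hβ', hsβ, hlβ⟩ := hBB' β hβ ((hle _ β (hB α hα)).trans (le_sup_right.trans hs.le))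
  have hα0 := proj_ne_zero_of_lead_eq hlα (hB α hα)
  have hβ0 := proj_ne_zero_of_lead_eq hlβ (hB β hβ)
  rw [lead_eq_lead_iff hα0 (hB α hα)] at hlα
  rw [lead_eq_lead_iff hβ0 (hB β hβ)] at hlβ
  have h1 : sig (proj g β' • α') = sig (proj g β • α) := by
    rw [hord.sig_smul hβ0, hord.sig_smul (hB β hβ), hlβ, hsα]
  have h2 : sig (proj g α' • β') = sig (proj g α • β) := by
    rw [hord.sig_smul hα0, hord.sig_smul (hB α hα), hlα, hsβ]
  have hne' : sig (proj g β' • α') ≠ sig (proj g α' • β') := by rwa [h1, h2]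
  exact ⟨α', hα', β', hβ', hne', by rw [koszul, sig_sub_of_ne hne', h1, h2, hs]⟩

end IsModTermOrder

/-- The signature `T` needs no further work: it is divisible by a known syzygy signature, or
the basis has an optimal multiple in signature `T`. -/
def Settled (ord : MonomialOrder σ) (g : Fin m → MvPolynomial σ K) (B : Set (ModVec σ K m))
    (Kn : Set (ModTerm σ m)) (T : ModTerm σ m) : Prop :=
  (∃ L ∈ Kn, L.Divides T) ∨ Covers ord g B T

lemma Settled.mono {B B' : Set (ModVec σ K m)} {Kn Kn' : Set (ModTerm σ m)} (hB : B ⊆ B')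
    (hK : Kn ⊆ Kn') {T : ModTerm σ m} (h : Settled ord g B Kn T) : Settled ord g B' Kn' T :=
  h.imp (fun ⟨L, hL, hd⟩ => ⟨L, hK hL, hd⟩) (Covers.mono hB)

namespace IsModTermOrder

variable (hord : IsModTermOrder (m := m) ord) {B : Set (ModVec σ K m)} {Kn : Set (ModTerm σ m)}
include hord

lemma Settled.isSyzSig_or_covers (hKn : ∀ L ∈ Kn, IsSyzSig g L) {T : ModTerm σ m}
    (h : Settled ord g B Kn T) : IsSyzSig g T ∨ Covers ord g B T :=
  h.imp_left fun ⟨L, hL, hd⟩ => hord.isSyzSig_of_divides (hKn L hL) hd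

lemma exists_multiple_of_sig (hu : Set.range (unit σ K) ⊆ B) (T : ModTerm σ m) :
    ∃ u ∈ multiples B, sig u = T := by
  refine ⟨_, monomial_smul_mem_multiples (mem_multiples_self (hu ⟨T.idx, rfl⟩)) T.exp
    (one_ne_zero (α := K)), ?_⟩
  rw [hord.sig_monomial_smul _ one_ne_zero, sig_unit]
  change ((⟨T.idx, T.exp + 0⟩ : ModTerm σ m) : WithBot (ModTerm σ m)) = T
  rw [add_zero]

variable [Finite σ]

/-- A non-optimal `u` shares its lead monomial with some element of signature below `T`; as
everything below `T` is in order, a basis multiple with this lead monomial exists there and reduces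
`u` regularly. -/
lemma isMin_of_not_regTopReducible {T : ModTerm σ m}
    (hlow : ∀ S < T, IsSyzSig g S ∨ Covers ord g B S) {u : ModVec σ K m} (hs : sig u = T)
    (hu : proj g u ≠ 0) (h : ¬ RegTopReducible ord g B u) : IsMin ord g u := by
  by_contra hmin
  obtain ⟨z, hz, hl⟩ := exists_sig_lt_of_not_isMin hs hmin
  obtain ⟨r, hr, hrl, hrs⟩ := hord.exists_reducer
    (fun S hS => hlow S (WithBot.coe_lt_coe.1 (hS.trans_lt hz))) (proj_ne_zero_of_lead_eq hl hu)
  exact h ((regTopReducible_iff hu).2 ⟨r, hr, hrl.trans hl, hrs.trans_lt (hz.trans_eq hs.symm)⟩)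

/-- Take the basis multiple of signature `T` with the smallest lead monomial. If it is not regular
top reducible, it is optimal. Otherwise the reduction comes from a regular S-pair whose signature
divides `T`; were that signature covered, multiplying up would give a basis multiple of signature
`T` with a smaller lead monomial, so a known syzygy signature divides `T`. -/
lemma settled_of_spairs (hunit : Set.range (unit σ K) ⊆ B) (hB : ∀ β ∈ B, proj g β ≠ 0)
    (hKn : ∀ L ∈ Kn, IsSyzSig g L) {T : ModTerm σ m}
    (hpairs : ∀ α ∈ B, ∀ β ∈ B, RegularSPair ord g α β → ∀ S : ModTerm σ m,
      sig (spair ord g α β) = S → S ≤ T → Settled ord g B Kn S) : Settled ord g B Kn T := by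
  have hwo := hord.wellFoundedLT
  induction T using WellFoundedLT.induction with
  | ind T ih =>
  have hlow : ∀ S < T, IsSyzSig g S ∨ Covers ord g B S := fun S hS =>
    Settled.isSyzSig_or_covers hord hKn
      (ih S hS fun α hα β hβ hreg L hL hLS => hpairs α hα β hβ hreg L hL (hLS.trans hS.le))
  have hwf : WellFounded (fun x y : WithBot ord.syn => x < y) := wellFounded_lt
  obtain ⟨u, ⟨hu, hus⟩, hmin⟩ := (InvImage.wf (lead ord g) hwf).has_min
    {u : ModVec σ K m | u ∈ multiples B ∧ sig u = T} (hord.exists_multiple_of_sig hunit T)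
  have hu0 := proj_ne_zero_of_mem_multiples hB hu
  by_cases hred : RegTopReducible ord g B u
  · rw [regTopReducible_iff hu0] at hred
    obtain ⟨r, hr, hl, hlt⟩ := hred
    obtain ⟨α, hα, a, c, hc, rfl⟩ := hu
    obtain ⟨β, hβ, b, d, hd, rfl⟩ := hr
    obtain ⟨hreg, S, e, hS, rfl, hless⟩ :=
      hord.exists_spair (hB α hα) (hB β hβ) hc hd hus hl hlt
    rcases hpairs α hα β hβ hreg S hS (hord.le_shift e S) with ⟨L, hL, hd⟩ | ⟨r, hr, hrs, -, hrm⟩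
    · exact Or.inl ⟨L, hL, hd.trans ⟨e, rfl⟩⟩
    · refine absurd (hless r (hrm _ (hS.trans hrs.symm))) (hmin _ ⟨?_, ?_⟩)
      · exact monomial_smul_mem_multiples hr e one_ne_zero
      · rw [hord.sig_monomial_smul e one_ne_zero, hrs]
        rfl
  · exact Or.inr ⟨u, hu, hus, hu0, hord.isMin_of_not_regTopReducible hlow hus hu0 hred⟩

end IsModTermOrder

end SPairs

/-! ### Invariants and progress of the algorithm -/

section Runs

variable {σ K : Type*} [Field K] {m : ℕ} [LinearOrder (ModTerm σ m)] {ord : MonomialOrder σ}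
  {g : Fin m → MvPolynomial σ K}

/-- The invariant of the algorithm; `N` contains the signatures of the S-pairs that are reduced
to syzygies. -/
structure SBInvariant (ord : MonomialOrder σ) (g : Fin m → MvPolynomial σ K)
    (N : Set (ModTerm σ m)) (st : SBState σ K m) : Prop where
  unit_subset : Set.range (unit σ K) ⊆ st.basis
  proj_ne_zero : ∀ β ∈ st.basis, proj g β ≠ 0
  basis_new : ∀ β ∈ st.basis, β ∈ Set.range (unit σ K) ∨ ∃ T : ModTerm σ m, sig β = T ∧
    IsNewSig ord g T ∧ IsMin ord g β ∧ ∃ q ∈ st.reduced, pairSig ord g q = T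
  finite_basis : st.basis.Finite
  finite_pairs : st.pairs.Finite
  mem_pairs : ∀ q ∈ st.pairs, q.1 ∈ st.basis ∧ q.2 ∈ st.basis ∧ RegularSPair ord g q.1 q.2
  known_syz : ∀ T ∈ st.known, IsSyzSig g T
  -- The origin of known signatures is remembered in order to show at the end that a non-Koszul
  -- minimal generator was obtained by a reduction.
  known_source : ∀ T ∈ st.known, (∃ q ∈ st.reduced, pairSig ord g q = T) ∨
    IsKoszulSig g st.basis T
  -- Each pair is queued in one orientation only, hence both orders appear.
  settled_pairs : ∀ α ∈ st.basis, ∀ β ∈ st.basis, RegularSPair ord g α β →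
    (α, β) ∈ st.pairs ∨ (β, α) ∈ st.pairs ∨
      ∀ T : ModTerm σ m, sig (spair ord g α β) = T → Settled ord g st.basis st.known T
  settled_reduced : ∀ q ∈ st.reduced, ∀ T : ModTerm σ m, pairSig ord g q = T →
    Settled ord g st.basis st.known T
  nodup_reduced : (st.reduced.map (pairSig ord g)).Nodup
  reduced_class : ∀ q ∈ st.reduced, ∃ T : ModTerm σ m, pairSig ord g q = T ∧
    (IsNewSig ord g T ∨ T ∈ N)

variable {N : Set (ModTerm σ m)} {st : SBState σ K m}

lemma IsKoszulSig.mono {B B' : Set (ModVec σ K m)} (h : B ⊆ B') {T : ModTerm σ m}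
    (hT : IsKoszulSig g B T) : IsKoszulSig g B' T := by
  obtain ⟨α, hα, β, hβ, hT⟩ := hT
  exact ⟨α, h hα, β, h hβ, hT⟩

lemma SBInvariant.init (hg : ∀ i, g i ≠ 0) : SBInvariant ord g N (sbInit ord g) where
  unit_subset := subset_rfl
  proj_ne_zero := by
    rintro _ ⟨i, rfl⟩
    rw [proj_unit]
    exact hg i
  basis_new _ h := Or.inl h
  finite_basis := Set.finite_range _
  finite_pairs := by
    refine (Set.finite_range fun p : Fin m × Fin m => (unit σ K p.1, unit σ K p.2)).subset ?_
    rintro _ ⟨i, j, -, rfl, -⟩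
    exact ⟨(i, j), rfl⟩
  mem_pairs := by
    rintro _ ⟨i, j, -, rfl, h⟩
    exact ⟨⟨i, rfl⟩, ⟨j, rfl⟩, h⟩
  known_syz _ h := absurd h (Set.notMem_empty _)
  known_source _ h := absurd h (Set.notMem_empty _)
  settled_pairs := by
    rintro _ ⟨i, rfl⟩ _ ⟨j, rfl⟩ h
    rcases lt_trichotomy i j with hij | rfl | hij
    · exact Or.inl ⟨i, j, hij, rfl, h⟩
    · exact absurd h (not_regularSPair_self _)
    · exact Or.inr (Or.inl ⟨j, i, hij, rfl, h.symm⟩)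
  settled_reduced _ h := absurd h List.not_mem_nil
  nodup_reduced := List.nodup_nil
  reduced_class _ h := absurd h List.not_mem_nil

namespace SBInvariant

/-- S-pairs of a settled signature can be dropped. -/
lemma remove (h : SBInvariant ord g N st) {p : ModVec σ K m × ModVec σ K m} {T : ModTerm σ m}
    (hp : pairSig ord g p = T) (hT : Settled ord g st.basis st.known T)
    {P : Set (ModVec σ K m × ModVec σ K m)} (hP : P ⊆ st.pairs) (hP' : st.pairs \ {p} ⊆ P) :
    SBInvariant ord g N ⟨st.basis, P, st.known, st.reduced⟩ where
  __ := h
  finite_pairs := h.finite_pairs.subset hP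
  mem_pairs q hq := h.mem_pairs q (hP hq)
  settled_pairs α hα β hβ hreg := by
    have hsettled : ∀ S : ModTerm σ m, pairSig ord g p = S →
        Settled ord g st.basis st.known S := by
      intro S hS
      rwa [← WithBot.coe_injective (hp.symm.trans hS)]
    rcases h.settled_pairs α hα β hβ hreg with hm | hm | hm
    · by_cases he : (α, β) = p
      · subst he
        exact Or.inr (Or.inr hsettled)
      · exact Or.inl (hP' ⟨hm, he⟩)
    · by_cases he : (β, α) = p
      · subst he
        refine Or.inr (Or.inr fun S hS => hsettled S ?_)
        rw [← hS, sig_spair_comm]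
        rfl
      · exact Or.inr (Or.inl (hP' ⟨hm, he⟩))
    · exact Or.inr (Or.inr hm)

lemma insert_known (h : SBInvariant ord g N st) {T : ModTerm σ m}
    (hT : IsKoszulSig g st.basis T) :
    SBInvariant ord g N ⟨st.basis, st.pairs, insert T st.known, st.reduced⟩ where
  __ := h
  known_syz := by
    rintro L (rfl | hL)
    · exact IsModTermOrder.isSyzSig_of_isKoszulSig hT
    · exact h.known_syz L hL
  known_source := by
    rintro L (rfl | hL)
    · exact Or.inr hT
    · exact h.known_source L hL
  settled_pairs α hα β hβ hreg := (h.settled_pairs α hα β hβ hreg).imp_right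
    (Or.imp_right fun h' S hS => (h' S hS).mono subset_rfl (Set.subset_insert _ _))
  settled_reduced q hq S hS := (h.settled_reduced q hq S hS).mono subset_rfl
    (Set.subset_insert _ _)

lemma nodup_cons (h : SBInvariant ord g N st) {p : ModVec σ K m × ModVec σ K m} {T : ModTerm σ m}
    (hp : pairSig ord g p = T) (hdup : ¬ DuplicateCriterion ord g st T) :
    ((p :: st.reduced).map (pairSig ord g)).Nodup := by
  rw [List.map_cons, List.nodup_cons]
  refine ⟨fun hm => hdup ?_, h.nodup_reduced⟩
  obtain ⟨q, hq, hqs⟩ := List.mem_map.1 hm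
  exact ⟨q, hq, hqs.trans hp⟩

lemma basis_new_cons (h : SBInvariant ord g N st) (p : ModVec σ K m × ModVec σ K m)
    (β : ModVec σ K m) (hβ : β ∈ st.basis) :
    β ∈ Set.range (unit σ K) ∨ ∃ T : ModTerm σ m, sig β = T ∧
      IsNewSig ord g T ∧ IsMin ord g β ∧ ∃ q ∈ p :: st.reduced, pairSig ord g q = T :=
  (h.basis_new β hβ).imp_right fun ⟨T, h1, h2, h3, q, hq, h4⟩ =>
    ⟨T, h1, h2, h3, q, List.mem_cons_of_mem _ hq, h4⟩

/-- The pair `p` stays in the queue here; recording `T` first settles its signature, after which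
`remove` applies. The same division is used in `insert_known` and `insert_basis`. -/
lemma insert_syzygy (h : SBInvariant ord g N st) {p : ModVec σ K m × ModVec σ K m}
    {T : ModTerm σ m} (hp : pairSig ord g p = T) (hdup : ¬ DuplicateCriterion ord g st T)
    (hT : IsSyzSig g T) (hN : T ∈ N) :
    SBInvariant ord g N ⟨st.basis, st.pairs, insert T st.known, p :: st.reduced⟩ where
  __ := h
  basis_new := h.basis_new_cons p
  known_syz := by
    rintro L (rfl | hL)
    · exact hT
    · exact h.known_syz L hL
  known_source := by
    rintro L (rfl | hL)
    · exact Or.inl ⟨p, List.mem_cons_self, hp⟩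
    · exact (h.known_source L hL).imp_left fun ⟨q, hq, hs⟩ => ⟨q, List.mem_cons_of_mem _ hq, hs⟩
  settled_pairs α hα β hβ hreg := (h.settled_pairs α hα β hβ hreg).imp_right
    (Or.imp_right fun h' S hS => (h' S hS).mono subset_rfl (Set.subset_insert _ _))
  settled_reduced q hq S hS := by
    rcases List.mem_cons.1 hq with rfl | hq
    · exact Or.inl ⟨T, Set.mem_insert _ _, WithBot.coe_injective (hp.symm.trans hS) ▸ T.divides_refl⟩
    · exact (h.settled_reduced q hq S hS).mono subset_rfl (Set.subset_insert _ _)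
  nodup_reduced := h.nodup_cons hp hdup
  reduced_class q hq := by
    rcases List.mem_cons.1 hq with rfl | hq
    · exact ⟨T, hp, Or.inr hN⟩
    · exact h.reduced_class q hq

lemma insert_basis (h : SBInvariant ord g N st) {p : ModVec σ K m × ModVec σ K m}
    {T : ModTerm σ m} (hp : pairSig ord g p = T) (hdup : ¬ DuplicateCriterion ord g st T)
    {v : ModVec σ K m} (hv : sig v = T) (hv0 : proj g v ≠ 0) (hmin : IsMin ord g v)
    (hT : IsNewSig ord g T) :
    SBInvariant ord g N ⟨insert v st.basis,
      st.pairs ∪ {q | q.1 ∈ st.basis ∧ q.2 = v ∧ RegularSPair ord g q.1 q.2},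
      st.known, p :: st.reduced⟩ where
  unit_subset := h.unit_subset.trans (Set.subset_insert _ _)
  proj_ne_zero := by
    rintro β (rfl | hβ)
    · exact hv0
    · exact h.proj_ne_zero β hβ
  basis_new := by
    rintro β (rfl | hβ)
    · exact Or.inr ⟨T, hv, hT, hmin, p, List.mem_cons_self, hp⟩
    · exact h.basis_new_cons p β hβ
  finite_basis := h.finite_basis.insert v
  finite_pairs := by
    refine h.finite_pairs.union ((h.finite_basis.image fun β => (β, v)).subset ?_)
    rintro ⟨α, β⟩ ⟨hα, rfl, -⟩
    exact ⟨α, hα, rfl⟩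
  mem_pairs := by
    rintro q (hq | ⟨h1, h2, h3⟩)
    · obtain ⟨h1, h2, h3⟩ := h.mem_pairs q hq
      exact ⟨Or.inr h1, Or.inr h2, h3⟩
    · exact ⟨Or.inr h1, Or.inl h2, h3⟩
  known_syz := h.known_syz
  known_source L hL := (h.known_source L hL).imp
    (fun ⟨q, hq, hs⟩ => ⟨q, List.mem_cons_of_mem _ hq, hs⟩)
    (IsKoszulSig.mono (Set.subset_insert _ _))
  settled_pairs := by
    rintro α (rfl | hα) β (rfl | hβ) hreg
    · exact absurd hreg (not_regularSPair_self _)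
    · exact Or.inr (Or.inl (Or.inr ⟨hβ, rfl, hreg.symm⟩))
    · exact Or.inl (Or.inr ⟨hα, rfl, hreg⟩)
    · exact (h.settled_pairs α hα β hβ hreg).imp Or.inl
        (Or.imp Or.inl fun h' S hS => (h' S hS).mono (Set.subset_insert _ _) subset_rfl)
  settled_reduced q hq S hS := by
    rcases List.mem_cons.1 hq with rfl | hq
    · rw [← WithBot.coe_injective (hp.symm.trans hS)]
      exact Or.inr ⟨v, mem_multiples_self (Set.mem_insert _ _), hv, hv0, hmin⟩
    · exact (h.settled_reduced q hq S hS).mono (Set.subset_insert _ _) subset_rfl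
  nodup_reduced := h.nodup_cons hp hdup
  reduced_class q hq := by
    rcases List.mem_cons.1 hq with rfl | hq
    · exact ⟨T, hp, Or.inl hT⟩
    · exact h.reduced_class q hq

end SBInvariant

namespace IsModTermOrder

variable (hord : IsModTermOrder (m := m) ord) [Finite σ]
include hord

/-- All S-pairs of signature at most `T` have left the queue, so the Buchberger criterion by
signature applies. It serves both below the next signature and, with an empty queue, in all
signatures. -/
lemma settled_of_forall_pairs (h : SBInvariant ord g N st) {T : ModTerm σ m}
    (hT : ∀ q ∈ st.pairs, T < pairSig ord g q) : Settled ord g st.basis st.known T := by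
  refine hord.settled_of_spairs h.unit_subset h.proj_ne_zero h.known_syz ?_
  intro α hα β hβ hreg S hS hST
  have hST' : (S : WithBot (ModTerm σ m)) ≤ T := WithBot.coe_le_coe.2 hST
  rcases h.settled_pairs α hα β hβ hreg with hm | hm | hm
  · exact absurd (hT _ hm) (not_lt.2 ((show pairSig ord g (α, β) = S from hS).trans_le hST'))
  · exact absurd (hT _ hm) (not_lt.2
      ((show pairSig ord g (β, α) = S from (sig_spair_comm β α).trans hS).trans_le hST'))
  · exact hm S hS

lemma settled_of_lt_next (h : SBInvariant ord g N st) {p : ModVec σ K m × ModVec σ K m}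
    {T : ModTerm σ m} (hp : IsNext ord g st p T) {S : ModTerm σ m} (hS : S < T) :
    Settled ord g st.basis st.known S :=
  hord.settled_of_forall_pairs h fun q hq =>
    ((WithBot.coe_lt_coe.2 hS).trans_eq hp.2.2.symm).trans_le (hp.2.1 q hq)

omit [Finite σ] in
-- If an optimal element in signature `T` were a proper multiple, its factor would lie in a smaller,
-- hence covered, signature, and multiplying up would cover `T`.
lemma isNewSig_of_not_covers {B : Set (ModVec σ K m)} (hunit : Set.range (unit σ K) ⊆ B)
    (hB : ∀ β ∈ B, proj g β ≠ 0) {T : ModTerm σ m}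
    (hlow : ∀ S < T, IsSyzSig g S ∨ Covers ord g B S) (hT : ¬ IsSyzSig g T)
    (hcov : ¬ Covers ord g B T) : IsNewSig ord g T := by
  refine ⟨⟨hT, fun a β hs hmin => ?_⟩, ?_⟩
  · by_contra ha
    obtain ⟨S, hS, rfl⟩ := hord.exists_sig_of_sig_monomial_smul one_ne_zero hs
    have hlt : S < S.shift a := by
      refine lt_of_le_of_ne (hord.le_shift a S) fun he => ha ?_
      have := congrArg ModTerm.exp he
      simpa [ModTerm.shift] using this
    obtain ⟨r, hr, hrs, -, hrm⟩ := (hlow S hlt).resolve_left fun h => hT (hord.isSyzSig_shift h a)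
    exact hcov (hord.covers_of_sig_lead_eq one_ne_zero hT hs hmin hr (hrs.trans hS.symm)
      (hrm.lead_eq (hord.isMin_of_monomial_smul one_ne_zero hmin) (hrs.trans hS.symm)))
  · rintro ⟨i, hs, hmin⟩
    exact hcov ⟨_, mem_multiples_self (hunit ⟨i, rfl⟩), hs, hB _ (hunit ⟨i, rfl⟩), hmin⟩

omit hord [Finite σ] in
-- A covering multiple has minimal lead monomial among all elements of its signature and, being
-- optimal, is not regular top reducible, so it triggers the criterion.
lemma not_covers_of_not_singularCriterion (hB : ∀ β ∈ st.basis, proj g β ≠ 0) {T : ModTerm σ m}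
    (h : ¬ SingularCriterion ord g st T) : ¬ Covers ord g st.basis T := by
  rintro ⟨r, hr, hs, h0, hmin⟩
  refine h ⟨r, hr, hs, fun v hv hvs => ?_, hmin.not_regTopReducible⟩
  rw [← lead_le_lead_iff h0 (proj_ne_zero_of_mem_multiples hB hv)]
  exact hmin v (hvs.trans hs.symm)

variable {k : ℕ} {w : Fin k → ModVec σ K m}

/-- S-pairs that regular reduce to syzygies have their signatures among the minimal generators
that are not Koszul signatures. -/
lemma mem_nonKoszulGens_of_notEliminated (hw : IsMinimalSigGB ord g w) (hg : ∀ i, g i ≠ 0)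
    {B : Set (ModVec σ K m)} {Kn : Set (ModTerm σ m)} (hunit : Set.range (unit σ K) ⊆ B)
    (hKn : ∀ L ∈ Kn, IsSyzSig g L) {T : ModTerm σ m} (hlow : ∀ S < T, Settled ord g B Kn S)
    (hT : IsSyzSig g T) (hsig : ¬ ∃ L ∈ Kn, L.Divides T) (hkos : ¬ IsKoszulSig g B T) :
    T ∈ nonKoszulGens g (extension w Set.univ) := by
  refine ⟨hord.mem_minGens_initialSyz_iff.2 ⟨hT, fun L hL hLT => ?_⟩, fun hK => hkos ?_⟩
  · by_contra hne
    rcases hlow L (lt_of_le_of_ne (hord.le_of_divides hLT) hne) with ⟨L', hL', hd⟩ | hc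
    · exact hsig ⟨L', hL', hd.trans hLT⟩
    · exact hc.not_isSyzSig hL
  · obtain ⟨-, hnew, -⟩ := hord.sig_of_isMinimalSigGB hw
    refine hord.isKoszulSig_congr ?_ ?_ hK
    · rintro _ (⟨i, rfl⟩ | ⟨j, -, rfl⟩)
      · rw [proj_unit]
        exact hg i
      · exact hw.proj_ne_zero j
    · rintro _ (⟨i, rfl⟩ | ⟨j, -, rfl⟩) hle
      · exact ⟨_, hunit ⟨i, rfl⟩, rfl, rfl⟩
      -- The signature of `w j` is not a syzygy signature, so it lies strictly below `T`, where the
      -- current basis already contains an optimal element of that primitive signature.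
      · obtain ⟨S, hS, hjs, hjm⟩ := hnew j
        rw [hjs, WithBot.coe_le_coe] at hle
        have hne : S ≠ T := by
          rintro rfl
          exact hS.1.1 hT
        obtain ⟨γ, hγ, hγs, hγm⟩ := hord.exists_mem_of_covers hS.1
          ((Settled.isSyzSig_or_covers hord hKn (hlow S (lt_of_le_of_ne hle hne))).resolve_left
            hS.1.1)
        exact ⟨γ, hγ, hγs.trans hjs.symm, hγm.lead_eq hjm (hγs.trans hjs.symm)⟩

/-- Each outcome settles the signature of `p`: by a known syzygy signature, an earlier reduction, an
existing optimal multiple or a new optimal element. -/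
lemma invariant_step (hw : IsMinimalSigGB ord g w) (hg : ∀ i, g i ≠ 0) {st st' : SBState σ K m}
    (h : SBInvariant ord g (nonKoszulGens g (extension w Set.univ)) st)
    (hstep : SBStep ord g st st') :
    SBInvariant ord g (nonKoszulGens g (extension w Set.univ)) st' := by
  have hlow : ∀ {p T}, IsNext ord g st p T → ∀ S < T, IsSyzSig g S ∨ Covers ord g st.basis S :=
    fun hp S hS => Settled.isSyzSig_or_covers hord h.known_syz (hord.settled_of_lt_next h hp hS)
  cases hstep with
  | eliminate p T hp hc =>
    refine h.remove hp.2.2 ?_ Set.sdiff_subset subset_rfl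
    rcases hc with hc | ⟨q, hq, hqs⟩ | ⟨u, hu, hus, -, hred⟩
    · exact Or.inl hc
    · exact h.settled_reduced q hq T hqs
    · have hu0 := proj_ne_zero_of_mem_multiples h.proj_ne_zero hu
      exact Or.inr ⟨u, hu, hus, hu0, hord.isMin_of_not_regTopReducible (hlow hp) hus hu0 hred⟩
  | eliminateKoszul p T hp hc =>
    have hK : IsKoszulSig g st.basis T := by
      rcases hc with hc | ⟨q, hq, hqs, hrel⟩
      · exact hc
      · obtain ⟨h1, h2, hreg⟩ := h.mem_pairs q hq
        obtain ⟨hne, hs⟩ := hord.sig_koszul_eq_sig_spair (h.proj_ne_zero _ h1)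
          (h.proj_ne_zero _ h2) hreg hrel
        exact ⟨q.1, h1, q.2, h2, hne, hs.trans hqs⟩
    exact (h.insert_known hK).remove hp.2.2 (Or.inl ⟨T, Set.mem_insert _ _, T.divides_refl⟩)
      Set.sdiff_subset subset_rfl
  | reduceToSyzygy p T v hp hne hred hv =>
    have hT : IsSyzSig g T := ⟨v, hred.sig_eq.trans hp.2.2, hv⟩
    have hN := hord.mem_nonKoszulGens_of_notEliminated hw hg h.unit_subset h.known_syz
      (fun S hS => hord.settled_of_lt_next h hp hS) hT hne.1 hne.2.2.1
    exact (h.insert_syzygy hp.2.2 hne.2.1 hT hN).remove hp.2.2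
      (Or.inl ⟨T, Set.mem_insert _ _, T.divides_refl⟩) Set.sdiff_subset subset_rfl
  -- This case never occurs: a singular top reducer of the optimal `v` would cover `T`, which the
  -- failed singular criterion excludes.
  | reduceToSingular p T v hp hne hred hv hsing =>
    have hvs : sig v = T := hred.sig_eq.trans hp.2.2
    have hmin := hord.isMin_of_not_regTopReducible (hlow hp) hvs hv hred.not_regTopReducible
    obtain ⟨r, hr, hl, hs⟩ := (singTopReducible_iff hv).1 hsing
    exact absurd ⟨r, hr, hs.trans hvs, proj_ne_zero_of_lead_eq hl hv, hmin.congr hs hl⟩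
      (not_covers_of_not_singularCriterion h.proj_ne_zero hne.2.2.2.2)
  | reduceToBasis p T v hp hne hred hv _ =>
    have hvs : sig v = T := hred.sig_eq.trans hp.2.2
    have hmin := hord.isMin_of_not_regTopReducible (hlow hp) hvs hv hred.not_regTopReducible
    have hnew := hord.isNewSig_of_not_covers h.unit_subset h.proj_ne_zero (hlow hp)
      (hmin.not_isSyzSig hvs hv)
      (not_covers_of_not_singularCriterion h.proj_ne_zero hne.2.2.2.2)
    refine (h.insert_basis hp.2.2 hne.2.1 hvs hv hmin hnew).remove hp.2.2
      (Or.inr ⟨v, mem_multiples_self (Set.mem_insert _ _), hvs, hv, hmin⟩)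
      -- The algorithm deletes `p` before adding the new pairs, so the resulting set is only
      -- sandwiched between the enlarged set with and without `p`.
      (Set.union_subset_union_left _ Set.sdiff_subset) ?_
    rintro q ⟨hq | hq, hqp⟩
    · exact Or.inl ⟨hq, hqp⟩
    · exact Or.inr hq

lemma invariant_of_reachable (hw : IsMinimalSigGB ord g w) (hg : ∀ i, g i ≠ 0)
    (h : SBReachable ord g st) :
    SBInvariant ord g (nonKoszulGens g (extension w Set.univ)) st := by
  induction h with
  | refl => exact SBInvariant.init hg
  | tail _ hstep ih => exact hord.invariant_step hw hg ih hstep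

/-- The signatures of the S-pairs reduced in a complete run. -/
lemma mem_map_pairSig_iff (hw : IsMinimalSigGB ord g w)
    (h : SBInvariant ord g (nonKoszulGens g (extension w Set.univ)) st) (hst : st.pairs = ∅)
    (s : WithBot (ModTerm σ m)) :
    s ∈ st.reduced.map (pairSig ord g) ↔ (∃ j, s = sig (w j)) ∨
      ∃ L ∈ nonKoszulGens g (extension w Set.univ), s = L := by
  obtain ⟨-, hnew, hall⟩ := hord.sig_of_isMinimalSigGB hw
  have hsettled : ∀ T, Settled ord g st.basis st.known T := fun T =>
    hord.settled_of_forall_pairs h fun q hq => absurd hq (by simp [hst])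
  rw [List.mem_map]
  constructor
  · rintro ⟨q, hq, rfl⟩
    obtain ⟨T, hT, hc | hc⟩ := h.reduced_class q hq
    · obtain ⟨j, hj⟩ := hall T hc
      exact Or.inl ⟨j, hT.trans hj.symm⟩
    · exact Or.inr ⟨T, hc, hT⟩
  · rintro (⟨j, rfl⟩ | ⟨L, hL, rfl⟩)
    · obtain ⟨T, hT, hjs, -⟩ := hnew j
      obtain ⟨β, hβ, hβs, hβm⟩ := hord.exists_mem_of_covers hT.1
        ((Settled.isSyzSig_or_covers hord h.known_syz (hsettled T)).resolve_left hT.1.1)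
      -- An optimal `e_i` is impossible in a new signature, so the element covering it was added by
      -- a reduction.
      rcases h.basis_new β hβ with ⟨i, rfl⟩ | ⟨S, hS, -, -, q, hq, hqs⟩
      · exact absurd ⟨i, hβs, hβm⟩ hT.2
      · exact ⟨q, hq, hqs.trans (hS.symm.trans (hβs.trans hjs.symm))⟩
    · obtain ⟨hLsyz, hLmin⟩ := hord.mem_minGens_initialSyz_iff.1 hL.1
      rcases hsettled L with ⟨L', hL', hd⟩ | hc
      -- Minimality makes `L` itself known. A Koszul origin in the current basis would transfer to
      -- the minimal basis, contradicting membership in `N`.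
      · obtain rfl := hLmin L' (h.known_syz L' hL') hd
        refine (h.known_source L' hL').resolve_right fun hK => hL.2 ?_
        refine hord.isKoszulSig_congr h.proj_ne_zero (fun β hβ _ => ?_) hK
        rcases h.basis_new β hβ with hu | ⟨S, hS, hnewS, hmin, -⟩
        · exact ⟨β, Or.inl hu, rfl, rfl⟩
        · obtain ⟨j, hj⟩ := hall S hnewS
          obtain ⟨-, -, -, hjm⟩ := hnew j
          exact ⟨w j, Or.inr ⟨j, trivial, rfl⟩, hj.trans hS.symm,
            hjm.lead_eq hmin (hj.trans hS.symm)⟩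
      · exact absurd hLsyz hc.not_isSyzSig

omit hord [Finite σ] in
-- The queue is finite, so a minimal signature exists; it is not `⊥` because the S-pair is regular,
-- and a regular reduction can always be completed.
lemma exists_step (h : SBInvariant ord g N st) (hst : st.pairs.Nonempty) :
    ∃ st', SBStep ord g st st' := by
  obtain ⟨p, hp, hmin⟩ := Set.exists_min_image _ (pairSig ord g) h.finite_pairs hst
  obtain ⟨T, hT⟩ := (h.mem_pairs p hp).2.2.exists_sig
  have hnext : IsNext ord g st p T := ⟨hp, hmin, hT⟩
  by_cases hne : NotEliminated ord g st T
  · obtain ⟨v, hv⟩ := exists_regReducesTo (ord := ord) (g := g) st.basis (spair ord g p.1 p.2)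
    by_cases h0 : proj g v = 0
    · exact ⟨_, .reduceToSyzygy st p T v hnext hne hv h0⟩
    · by_cases hs : SingTopReducible ord g st.basis v
      · exact ⟨_, .reduceToSingular st p T v hnext hne hv h0 hs⟩
      · exact ⟨_, .reduceToBasis st p T v hnext hne hv h0 hs⟩
  · by_cases hk : KoszulCriterion g st T ∨ RelPrimeCriterion ord g st T
    · exact ⟨_, .eliminateKoszul st p T hnext hk⟩
    · refine ⟨_, .eliminate st p T hnext ?_⟩
      simp only [NotEliminated] at hne
      tauto

omit hord [Finite σ] in
lemma reduced_or_pairs_of_step {st st' : SBState σ K m} (h : SBStep ord g st st') :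
    st'.reduced.length = st.reduced.length + 1 ∨
      st'.reduced = st.reduced ∧ st'.pairs ⊂ st.pairs := by
  have hss : ∀ {p T}, IsNext ord g st p T → st.pairs \ {p} ⊂ st.pairs := fun hp =>
    Set.sdiff_singleton_ssubset.2 hp.1
  cases h with
  | eliminate p T hp => exact Or.inr ⟨rfl, hss hp⟩
  | eliminateKoszul p T hp => exact Or.inr ⟨rfl, hss hp⟩
  | reduceToSyzygy => exact Or.inl rfl
  | reduceToSingular => exact Or.inl rfl
  | reduceToBasis => exact Or.inl rfl

end IsModTermOrder

end Runs

end SigBasis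

end

/-! ### Counting the reductions -/

theorem mainTheorem1 {σ K : Type*} [Finite σ] [Field K] {m : ℕ} (ord : MonomialOrder σ)
    [LinearOrder (SigBasis.ModTerm σ m)] (hord : SigBasis.IsModTermOrder (m := m) ord)
    (g : Fin m → MvPolynomial σ K) (hg : ∀ i, g i ≠ 0)
    {k : ℕ} (w : Fin k → SigBasis.ModVec σ K m) (hw : SigBasis.IsMinimalSigGB ord g w) :
    -- every run is finite, and a run can be continued as long as S-pairs are waiting
    (¬ ∃ run : ℕ → SigBasis.SBState σ K m, run 0 = SigBasis.sbInit ord g ∧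
        ∀ i, SigBasis.SBStep ord g (run i) (run (i + 1))) ∧
    (∀ st, SigBasis.SBReachable ord g st → st.pairs.Nonempty →
        ∃ st', SigBasis.SBStep ord g st st') ∧
    -- the two kinds of objects have pairwise distinct signatures
    Function.Injective (fun j => SigBasis.sig (w j)) ∧
    (∀ j, ∀ L ∈ SigBasis.nonKoszulGens g (SigBasis.extension w Set.univ),
        SigBasis.sig (w j) ≠ L) ∧
    (SigBasis.nonKoszulGens g (SigBasis.extension w Set.univ)).Finite ∧
    -- a complete run reduces exactly one S-pair in each of these signatures, and no others
    (∀ st, SigBasis.SBReachable ord g st → st.pairs = ∅ →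
        (st.reduced.map (SigBasis.pairSig ord g)).Nodup ∧
        (∀ s, s ∈ st.reduced.map (SigBasis.pairSig ord g) ↔
          (∃ j, s = SigBasis.sig (w j)) ∨
          ∃ L ∈ SigBasis.nonKoszulGens g (SigBasis.extension w Set.univ), s = L) ∧
        st.reduced.length =
          k + (SigBasis.nonKoszulGens g (SigBasis.extension w Set.univ)).ncard) := by
  classical
  obtain ⟨hinj, hnew, hall⟩ := hord.sig_of_isMinimalSigGB hw
  set N := SigBasis.nonKoszulGens g (SigBasis.extension w Set.univ) with hN
  have hdisj : ∀ j, ∀ L ∈ N, SigBasis.sig (w j) ≠ L := by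
    intro j L hL he
    obtain ⟨T, hT, hjs, -⟩ := hnew j
    obtain rfl := WithBot.coe_injective (hjs.symm.trans he)
    exact hT.1.1 (hord.mem_minGens_initialSyz_iff.1 hL.1).1
  have hfin : N.Finite := (SigBasis.finite_minGens _).subset fun L hL => hL.1
  -- the signatures in which S-pairs are reduced
  let F : Finset (WithBot (SigBasis.ModTerm σ m)) :=
    Finset.univ.image (fun j => SigBasis.sig (w j)) ∪ hfin.toFinset.image WithBot.some
  have hFmem : ∀ s, s ∈ F ↔ (∃ j, s = SigBasis.sig (w j)) ∨ ∃ L ∈ N, s = L := by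
    intro s
    simp [F, eq_comm]
  have hFcard : F.card = k + N.ncard := by
    rw [Finset.card_union_of_disjoint, Finset.card_image_of_injective _ hinj,
      Finset.card_image_of_injective _ WithBot.coe_injective, Finset.card_univ, Fintype.card_fin,
      Set.ncard_eq_toFinset_card _ hfin]
    rw [Finset.disjoint_left]
    intro s hs hs'
    obtain ⟨j, -, rfl⟩ := Finset.mem_image.1 hs
    obtain ⟨L, hL, he⟩ := Finset.mem_image.1 hs'
    exact hdisj j L (hfin.mem_toFinset.1 hL) he.symm
  -- In every reachable state the reduced pairs have distinct signatures, all in `F`.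
  have hlen : ∀ st, SigBasis.SBReachable ord g st → st.reduced.length ≤ F.card := by
    intro st hst
    have h := hord.invariant_of_reachable hw hg hst
    rw [← List.length_map (SigBasis.pairSig ord g), ← List.toFinset_card_of_nodup h.nodup_reduced]
    refine Finset.card_le_card fun s hs => ?_
    obtain ⟨q, hq, rfl⟩ := List.mem_map.1 (List.mem_toFinset.1 hs)
    obtain ⟨T, hT, hc | hc⟩ := h.reduced_class q hq
    · obtain ⟨j, hj⟩ := hall T hc
      exact (hFmem _).2 (Or.inl ⟨j, hT.trans hj.symm⟩)
    · exact (hFmem _).2 (Or.inr ⟨T, hc, hT⟩)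
  refine ⟨?_, fun st hst hne => SigBasis.IsModTermOrder.exists_step
    (hord.invariant_of_reachable hw hg hst) hne, hinj, hdisj, hfin, fun st hst hemp => ?_⟩
  · rintro ⟨run, h0, hrun⟩
    have hreach : ∀ i, SigBasis.SBReachable ord g (run i) := by
      intro i
      induction i with
      | zero => exact h0 ▸ .refl
      | succ i ih => exact ih.tail (hrun i)
    -- A reduction lowers the first component, truncated subtraction being harmless by `hlen`; an
    -- elimination keeps it and shrinks the finite queue.
    let f : ℕ → ℕ ×ₗ ℕ := fun i => toLex (F.card - (run i).reduced.length, (run i).pairs.ncard)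
    refine not_strictAnti_of_wellFoundedLT f (strictAnti_nat_of_succ_lt fun i => ?_)
    rw [Prod.Lex.toLex_lt_toLex]
    rcases SigBasis.IsModTermOrder.reduced_or_pairs_of_step (hrun i) with h | ⟨h1, h2⟩
    · have := hlen _ (hreach (i + 1))
      exact Or.inl (by simp only; omega)
    · refine Or.inr ⟨by simp only [h1], Set.ncard_lt_ncard h2 ?_⟩
      exact (hord.invariant_of_reachable hw hg (hreach i)).finite_pairs
  · have h := hord.invariant_of_reachable hw hg hst
    have hmem := hord.mem_map_pairSig_iff hw h hemp
    refine ⟨h.nodup_reduced, hmem, ?_⟩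
    rw [← hFcard, ← List.length_map (SigBasis.pairSig ord g),
      ← List.toFinset_card_of_nodup h.nodup_reduced]
    congr 1
    ext s
    rw [List.mem_toFinset, hmem, hFmem]
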